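/- **Definitions.** The Selberg class $\mathcal S$ is the set of Dirichlet series $F(s)=\sum_{n\ge 1}a_n n^{-s}$ such that: 1. (Analyticity) for some integer $m\ge 0$, $(s-1)^mF(s)$ extends to an entire function of finite order; 2. (Ramanujan hypothesis) $a_n\ll_\varepsilon n^{\varepsilon}$ for every fixed $\varepsilon>0$; 3. (Functional equation) there are $\epsilon\in\mathbb C$ with $|\epsilon|=1$, $Q>0$, $k\ge 0$, $w_i>0$ and $\mu_i\in\mathbb C$ with $\Re\mu_i\ge 0$ $(1\le i\le k)$ such that $\Phi(s)=\epsilon\,Q^s\prod_{i=1}^k\Gamma(w_is+\mu_i)\,F(s)$ satisfies $\Phi(s)=\overline{\Phi(1-\overline s)}$ as an identity of meromorphic functions; 4. (Euler product) $a_1=1$ and $\log F(s)=\sum_{n\ge 1}b_nn^{-s}$ for $\Re s>1$, where $b_n=0$ unless $n$ is a positive power of a prime, and $b_n\ll n^{\theta}$ for some $\theta<1/2$. An element $F\in\mathcal S$ is called primitive if $F\ne 1$ and $F=F_1F_2$ with $F_1,F_2\in\mathcal S$ implies $F_1=1$ or $F_2=1$. Write $a_n(F)$ for the coefficients of $F$;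 sums over $p$ run over primes. **Proposition 4.4.** Assume Selberg's conjectures: * (Regularity of distribution) for each $F\in\mathcal S$ there is an integer $n_F$ such that $$\sum_{p\le x}\frac{|a_p(F)|^2}{p}=n_F\log\log x+O(1)\qquad(x\to\infty);$$ * (Orthonormality) if $F$ and $F'$ are distinct and primitive, then $n_F=1$ and $$\sum_{p\le x}\frac{a_p(F)\,\overline{a_p(F')}}{p}=O(1)\qquad(x\to\infty).$$ Then $\mathcal S$ has unique factorization: every $F\in\mathcal S$ is a product of finitely many (possibly zero) primitive elements of $\mathcal S$, and the multiset of primitive factors is uniquely determined by $F$. -/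

import Mathlib

open Asymptotics Filter

namespace Selberg

/-- A Dirichlet series `F(s) = ∑ aₙ n⁻ˢ` is represented by its coefficients, an arithmetic function
`a : ArithmeticFunction ℂ`; its value where it converges is `LSeries a s`. The product of Dirichlet
series is the product of `ArithmeticFunction ℂ` (Dirichlet convolution), and the series `F = 1` is
the unit `1`.

`HasAnalyticity a F`: the function `F` continues the Dirichlet series from `Re s > 1`, and
`(s - 1) ^ m * F s` is an entire function `G` of finite order for some `m`. (The value `F 1` is
immaterial, as `F` may have a pole there.) -/
def HasAnalyticity (a : ArithmeticFunction ℂ) (F : ℂ → ℂ) : Prop :=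
  (∀ s : ℂ, 1 < s.re → F s = LSeries a s) ∧
  ∃ (m : ℕ) (G : ℂ → ℂ), Differentiable ℂ G ∧
    (∃ ρ : ℝ, G =O[Bornology.cobounded ℂ] fun s => Real.exp (‖s‖ ^ ρ)) ∧
    ∀ s : ℂ, s ≠ 1 → G s = (s - 1) ^ m * F s

/-- Ramanujan hypothesis: `aₙ ≪ n ^ ε` for every fixed `ε > 0`. -/
def HasRamanujan (a : ArithmeticFunction ℂ) : Prop :=
  ∀ ε : ℝ, 0 < ε → (fun n : ℕ => a n) =O[atTop] fun n : ℕ => (n : ℝ) ^ ε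

/-- The gamma factor `γ(s) = ε Qˢ ∏ᵢ Γ(wᵢ s + μᵢ)`. -/
noncomputable def gammaFactor (ε : ℂ) (Q : ℝ) {k : ℕ} (w : Fin k → ℝ) (μ : Fin k → ℂ) (s : ℂ) : ℂ :=
  ε * (Q : ℂ) ^ s * ∏ i, Complex.Gamma (w i * s + μ i)

/-- `s` is not a pole of the gamma factor: no argument `wᵢ s + μᵢ` is one of `0, -1, -2, …`. -/
def GammaRegularAt {k : ℕ} (w : Fin k → ℝ) (μ : Fin k → ℂ) (s : ℂ) : Prop :=
  ∀ (i : Fin k) (n : ℕ), (w i : ℂ) * s + μ i ≠ -(n : ℂ)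

/-- Functional equation: with `Φ(s) = γ(s) F(s)`, the meromorphic identity
`Φ(s) = conj (Φ (1 - conj s))`, stated at all points where no factor on either side has a pole
(`s = 1` and `s = 0` being the possible poles of `F(s)` and `F(1 - conj s)`). The number `k` of gamma
functions may be zero. -/
def HasFunctionalEquation (F : ℂ → ℂ) : Prop :=
  ∃ (ε : ℂ) (Q : ℝ) (k : ℕ) (w : Fin k → ℝ) (μ : Fin k → ℂ),
    ‖ε‖ = 1 ∧ 0 < Q ∧ (∀ i, 0 < w i) ∧ (∀ i, 0 ≤ (μ i).re) ∧
    ∀ s : ℂ, s ≠ 0 → s ≠ 1 →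
      GammaRegularAt w μ s → GammaRegularAt w μ (1 - starRingEnd ℂ s) →
      gammaFactor ε Q w μ s * F s =
        starRingEnd ℂ (gammaFactor ε Q w μ (1 - starRingEnd ℂ s) * F (1 - starRingEnd ℂ s))

/-- Euler product: `a₁ = 1` and `log F(s) = ∑ bₙ n⁻ˢ` for `Re s > 1`, where `bₙ = 0` unless `n` is a
positive power of a prime, and `bₙ ≪ n ^ θ` for some `θ < 1/2`. -/
def HasEulerProduct (a : ArithmeticFunction ℂ) : Prop :=
  a 1 = 1 ∧
  ∃ (b : ℕ → ℂ) (θ : ℝ), θ < 1 / 2 ∧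
    (∀ n : ℕ, ¬ IsPrimePow n → b n = 0) ∧
    (b =O[atTop] fun n : ℕ => (n : ℝ) ^ θ) ∧
    ∀ s : ℂ, 1 < s.re → LSeriesSummable b s ∧ Complex.exp (LSeries b s) = LSeries a s

/-- The Selberg class `𝒮`, as a set of Dirichlet series. -/
def SelbergClass : Set (ArithmeticFunction ℂ) :=
  {a | (∃ F : ℂ → ℂ, HasAnalyticity a F ∧ HasFunctionalEquation F) ∧
    HasRamanujan a ∧ HasEulerProduct a}

/-- `F ∈ 𝒮` is primitive if `F ≠ 1` and `F = F₁ F₂` with `F₁, F₂ ∈ 𝒮` implies `F₁ = 1` or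
`F₂ = 1`. -/
def IsPrimitive (F : ArithmeticFunction ℂ) : Prop :=
  F ∈ SelbergClass ∧ F ≠ 1 ∧
    ∀ F₁ ∈ SelbergClass, ∀ F₂ ∈ SelbergClass, F = F₁ * F₂ → F₁ = 1 ∨ F₂ = 1

/-- `n_F = n`, i.e. `∑_{p ≤ x} |aₚ|² / p = n log log x + O(1)` as `x → ∞`. (There is at most one such
`n`, since `log log x → ∞`.) -/
def HasSelbergNumber (a : ArithmeticFunction ℂ) (n : ℤ) : Prop :=
  (fun x : ℝ => (∑ p ∈ Finset.Iic ⌊x⌋₊ with p.Prime, ‖a p‖ ^ 2 / (p : ℝ))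
      - (n : ℝ) * Real.log (Real.log x)) =O[atTop] fun _ : ℝ => (1 : ℝ)

/-- Selberg's conjecture on regularity of distribution. -/
def RegularityConjecture : Prop :=
  ∀ F ∈ SelbergClass, ∃ n : ℤ, HasSelbergNumber F n

/-- Selberg's orthonormality conjecture: if `F` and `F'` are distinct and primitive, then `n_F = 1`
and `∑_{p ≤ x} aₚ conj(a'ₚ) / p = O(1)`. -/
def OrthonormalityConjecture : Prop :=
  ∀ F F' : ArithmeticFunction ℂ, IsPrimitive F → IsPrimitive F' → F ≠ F' →
    HasSelbergNumber F 1 ∧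
    (fun x : ℝ => ∑ p ∈ Finset.Iic ⌊x⌋₊ with p.Prime, F p * starRingEnd ℂ (F' p) / (p : ℂ))
      =O[atTop] fun _ : ℝ => (1 : ℝ)

end Selberg

/-! ### Ratios of gamma functions on vertical lines -/

namespace Selberg

open Complex Bornology Topology

/-! Existence of factorizations is a degree argument. The functional equation compares `F` on `Re s
= -A` with `F` on `Re s = 1 + A`. On the latter line `|F|` lies between positive constants, above by
absolute convergence and below by the Euler product. Hence `|F(-A + it)|` has size `|t| ^ (W (1 +
2A))`, up to an error in the exponent bounded independently of `A`, where `W = ∑ wᵢ`. Letting `A →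
∞` shows that `W` depends on `F` alone (`HasHalfDegree.le`), whatever gamma factors are chosen. It
is additive under products, so splitting must stop once every `F ≠ 1` is known to have `W ≥ 1/4`
(`HasHalfDegree.ge_of_ne_one`).

This gap has two halves. Integrating `F(s) N ^ s exp(ε s²)` over a vertical line isolates the
coefficient of index `N`, and moving the line to `Re s = -A` turns growth bounds for `F` into bounds
for coefficients. If `W < 1/4`, then, once the pole is removed, the coefficients decay faster than
any power. The series converges everywhere and is bounded on vertical lines, which contradicts the
growth above unless `W = 0` (`SatisfiesFE.sum_nonpos`). If there are no gamma factors, the same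
integral shows that `F` is a Dirichlet polynomial whose last index `M` is at most `Q²`, and the
functional equation far to the left gives `|a_M| ≥ Q ≥ √M`. The Euler product with `θ < 1/2` gives
`|a_M| < √M` when `M > 1` (`norm_last_coeff_lt`), so `F = 1`.

Uniqueness is linear algebra over primes. Since `a₁ = 1`, the coefficient at a prime is additive
under products, so by orthonormality the pairing of `F` with a primitive `P` is `m log log x +
O(1)`, where `m` is the multiplicity of `P` in any factorization. Orthonormality says nothing if
there is only one primitive element; then it suffices that its powers are distinct. -/

theorem norm_Gamma_le_of_pos {x a : ℝ} (hx : 0 < x) (ha : 0 ≤ a) :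
    ∃ C : ℝ, 0 < C ∧ ∀ z : ℂ, z.re = x → ‖Gamma z‖ ≤ C * ‖Gamma (z + a)‖ := by
  rcases ha.eq_or_lt with rfl | ha
  · exact ⟨1, one_pos, fun z _ => by simp⟩
  -- `Γ(z) Γ(a) = Γ(z + a) B(z, a)`, and the absolute value of the beta integrand depends on `z`
  -- only through its real part, so `K` bounds `B(z, a)` on the whole line.
  set K : ℝ := ∫ t in (0 : ℝ)..1, t ^ (x - 1) * (1 - t) ^ (a - 1) with hK
  have hΓ : 0 < ‖Gamma (a : ℂ)‖ := by
    rw [norm_pos_iff]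
    exact Gamma_ne_zero_of_re_pos (by simpa using ha)
  have hbeta : ∀ z : ℂ, z.re = x → ‖betaIntegral z a‖ ≤ K := by
    intro z hz
    rw [betaIntegral, hK]
    refine (intervalIntegral.norm_integral_le_integral_norm zero_le_one).trans (le_of_eq ?_)
    refine intervalIntegral.integral_congr_ae ?_
    have h1 : ∀ᵐ t : ℝ, t ≠ 1 := by simp [MeasureTheory.ae_iff, MeasureTheory.measure_singleton]
    filter_upwards [h1] with t ht1 ht
    rw [Set.uIoc_of_le zero_le_one] at ht
    have h2 : (1 - (t : ℂ)) = ((1 - t : ℝ) : ℂ) := by push_cast; ring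
    rw [norm_mul, h2, norm_cpow_eq_rpow_re_of_pos ht.1,
      norm_cpow_eq_rpow_re_of_pos (sub_pos.2 (lt_of_le_of_ne ht.2 ht1))]
    simp [hz]
  have hK0 : 0 ≤ K := (norm_nonneg _).trans (hbeta x (by simp))
  refine ⟨(K + 1) / ‖Gamma (a : ℂ)‖, by positivity, fun z hz => ?_⟩
  have h := Gamma_mul_Gamma_eq_betaIntegral (s := z) (t := a) (by rw [hz]; exact hx) (by simpa)
  have h' := congrArg norm h
  rw [norm_mul, norm_mul] at h'
  rw [div_mul_eq_mul_div, le_div_iff₀ hΓ, h', mul_comm]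
  gcongr
  linarith [hbeta z hz]

theorem ne_zero_of_one_le_abs_im {z : ℂ} (h : 1 ≤ |z.im|) : z ≠ 0 := by
  rintro rfl
  norm_num at h

/-- The recurrence `Γ(z + 1) = z Γ(z)` carries the bound one unit to the left at the cost of `|z +
a| / |z| ≤ 1 + a`. The condition on the imaginary part avoids the poles and gives `|z| ≥ 1`. -/
theorem norm_Gamma_le {x a : ℝ} (ha : 0 ≤ a) :
    ∃ C : ℝ, 0 < C ∧ ∀ z : ℂ, z.re = x → 1 ≤ |z.im| → ‖Gamma z‖ ≤ C * ‖Gamma (z + a)‖ := by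
  obtain ⟨n, hn⟩ := exists_nat_gt (-x)
  induction n generalizing x with
  | zero =>
    obtain ⟨C, hC, h⟩ := norm_Gamma_le_of_pos (x := x) (by simpa using hn) ha
    exact ⟨C, hC, fun z hz _ => h z hz⟩
  | succ n ih =>
    obtain ⟨C, hC, h⟩ := ih (x := x + 1) (by push_cast at hn; linarith)
    refine ⟨C * (1 + a), by positivity, fun z hz hz1 => ?_⟩
    have hz0 : z ≠ 0 := ne_zero_of_one_le_abs_im hz1
    have hza : z + a ≠ 0 := ne_zero_of_one_le_abs_im (by simpa using hz1)
    have h1 := h (z + 1) (by simp [hz]) (by simpa using hz1)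
    rw [show z + 1 + a = (z + a) + 1 by ring, Gamma_add_one _ hz0, Gamma_add_one _ hza,
      norm_mul, norm_mul] at h1
    have hz2 : 1 ≤ ‖z‖ := hz1.trans (abs_im_le_norm z)
    have h2 : ‖z + a‖ ≤ (1 + a) * ‖z‖ := by
      refine (norm_add_le _ _).trans ?_
      rw [Complex.norm_real, Real.norm_of_nonneg ha]
      nlinarith
    have h3 : ‖z‖ * ‖Gamma z‖ ≤ ‖z‖ * (C * (1 + a) * ‖Gamma (z + a)‖) := by
      refine h1.trans ?_
      calc C * (‖z + a‖ * ‖Gamma (z + a)‖) ≤ C * ((1 + a) * ‖z‖ * ‖Gamma (z + a)‖) := by gcongr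
        _ = _ := by ring
    exact le_of_mul_le_mul_left h3 (by linarith)

theorem abs_im_pow_mul_norm_Gamma_le {z : ℂ} (h : 1 ≤ |z.im|) (n : ℕ) :
    |z.im| ^ n * ‖Gamma z‖ ≤ ‖Gamma (z + n)‖ := by
  induction n with
  | zero => simp
  | succ n ih =>
    have h0 : z + n ≠ 0 := ne_zero_of_one_le_abs_im (by simpa using h)
    rw [Nat.cast_succ, ← add_assoc, Gamma_add_one _ h0, norm_mul, pow_succ, mul_right_comm,
      mul_comm]
    gcongr
    simpa using abs_im_le_norm (z + n)

theorem norm_Gamma_add_nat_le {z : ℂ} (h : 1 ≤ |z.im|) (n : ℕ) :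
    ‖Gamma (z + n)‖ ≤ ((|z.re| + 1 + n) * |z.im|) ^ n * ‖Gamma z‖ := by
  have key : ∀ m ≤ n, ‖Gamma (z + m)‖ ≤ ((|z.re| + 1 + n) * |z.im|) ^ m * ‖Gamma z‖ := by
    intro m hm
    induction m with
    | zero => simp
    | succ m ih =>
      have h0 : z + m ≠ 0 := ne_zero_of_one_le_abs_im (by simpa using h)
      rw [Nat.cast_succ, ← add_assoc, Gamma_add_one _ h0, norm_mul, pow_succ, mul_right_comm,
        mul_comm]
      refine mul_le_mul (ih (by omega)) ?_ (norm_nonneg _) (by positivity)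
      have h1 : ‖z + m‖ ≤ |z.re| + |z.im| + m :=
        (norm_add_le _ _).trans (add_le_add (norm_le_abs_re_add_abs_im z) (by simp))
      have h2 : (m : ℝ) ≤ n := by exact_mod_cast (by omega : m ≤ n)
      nlinarith [abs_nonneg z.re, mul_le_mul_of_nonneg_left h (abs_nonneg z.re),
        mul_le_mul_of_nonneg_left h (Nat.cast_nonneg (α := ℝ) n)]
  exact key n le_rfl

/-- A coarse substitute for Stirling: the integer part of the shift is handled by the recurrence,
the fractional part by monotonicity up to a constant. Rounding loses less than one power of `|t|`
per gamma factor, whatever the shift, and this is harmless as the shift tends to infinity. -/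
theorem pow_floor_mul_Gamma_le {x a : ℝ} (ha : 0 ≤ a) :
    ∃ C : ℝ, ∀ z : ℂ, z.re = x → 1 ≤ |z.im| →
      |z.im| ^ ⌊a⌋₊ * ‖Gamma z‖ ≤ C * ‖Gamma (z + a)‖ := by
  have h0 : 0 ≤ a - ⌊a⌋₊ := sub_nonneg.2 (Nat.floor_le ha)
  obtain ⟨C, hC, h⟩ := norm_Gamma_le (x := x + ⌊a⌋₊) h0
  refine ⟨C, fun z hz hz1 => (abs_im_pow_mul_norm_Gamma_le hz1 _).trans ?_⟩
  have := h (z + ⌊a⌋₊) (by simp [hz]) (by simpa using hz1)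
  rwa [add_assoc, ← Complex.ofReal_natCast, ← Complex.ofReal_add, add_sub_cancel] at this

theorem norm_Gamma_add_le_pow_ceil {x a : ℝ} :
    ∃ C : ℝ, ∀ z : ℂ, z.re = x → 1 ≤ |z.im| →
      ‖Gamma (z + a)‖ ≤ C * (|z.im| ^ ⌈a⌉₊ * ‖Gamma z‖) := by
  have h0 : 0 ≤ ⌈a⌉₊ - a := sub_nonneg.2 (Nat.le_ceil a)
  obtain ⟨C, hC, h⟩ := norm_Gamma_le (x := x + a) h0
  refine ⟨C * (|x| + 1 + ⌈a⌉₊) ^ ⌈a⌉₊, fun z hz hz1 => ?_⟩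
  have h1 := h (z + a) (by simp [hz]) (by simpa using hz1)
  have h2 : z + a + ((⌈a⌉₊ - a : ℝ) : ℂ) = z + ⌈a⌉₊ := by push_cast; ring
  rw [h2] at h1
  refine h1.trans ?_
  rw [mul_assoc]
  gcongr
  rw [← mul_assoc, ← mul_pow, ← hz]
  exact norm_Gamma_add_nat_le hz1 _

theorem tendsto_affine_cobounded {w : ℝ} (hw : w ≠ 0) (ν : ℝ) :
    Tendsto (fun t : ℝ => w * t + ν) (cobounded ℝ) (cobounded ℝ) := by
  rw [← tendsto_norm_atTop_iff_cobounded]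
  have h1 : Tendsto (fun t : ℝ => |w| * ‖t‖ - |ν|) (cobounded ℝ) atTop :=
    tendsto_atTop_add_const_right _ _
      ((tendsto_norm_cobounded_atTop).const_mul_atTop (abs_pos.2 hw))
  refine tendsto_atTop_mono (fun t => ?_) h1
  have := norm_sub_norm_le (w * t) (-ν)
  simpa [abs_mul] using this

theorem eventually_one_le_abs_affine {w : ℝ} (hw : w ≠ 0) (ν : ℝ) :
    ∀ᶠ t in cobounded ℝ, 1 ≤ |w * t + ν| :=
  (tendsto_norm_cobounded_atTop.comp (tendsto_affine_cobounded hw ν)).eventually_ge_atTop 1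

theorem isBigO_affine_id {w : ℝ} (ν : ℝ) :
    (fun t : ℝ => w * t + ν) =O[cobounded ℝ] fun t : ℝ => t := by
  refine IsBigO.add (isBigO_const_mul_self _ _ _) ?_
  refine IsBigO.of_bound |ν| ?_
  filter_upwards [tendsto_norm_cobounded_atTop.eventually_ge_atTop 1] with t ht
  rw [Real.norm_eq_abs]
  exact le_mul_of_one_le_right (abs_nonneg _) ht

theorem isBigO_id_affine {w : ℝ} (hw : w ≠ 0) (ν : ℝ) :
    (fun t : ℝ => t) =O[cobounded ℝ] fun t : ℝ => w * t + ν := by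
  have h := (isBigO_affine_id (w := w⁻¹) (-(w⁻¹ * ν))).comp_tendsto (tendsto_affine_cobounded hw ν)
  refine h.congr_left fun t => ?_
  simp only [Function.comp]
  field_simp
  ring

/-- The point `σ + i t`. -/
noncomputable def vert (σ t : ℝ) : ℂ := σ + t * I

@[simp] theorem vert_re (σ t : ℝ) : (vert σ t).re = σ := by simp [vert]

@[simp] theorem vert_im (σ t : ℝ) : (vert σ t).im = t := by simp [vert]

theorem one_sub_conj_vert (σ t : ℝ) : 1 - starRingEnd ℂ (vert σ t) = vert (1 - σ) t := by
  apply Complex.ext <;> simp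

theorem affine_vert_im (w σ t : ℝ) (μ : ℂ) : ((w : ℂ) * vert σ t + μ).im = w * t + μ.im := by
  simp

theorem affine_vert_re (w σ t : ℝ) (μ : ℂ) : ((w : ℂ) * vert σ t + μ).re = w * σ + μ.re := by
  simp

theorem affine_vert_shift (w A t : ℝ) (μ : ℂ) :
    (w : ℂ) * vert (1 + A) t + μ = (w * vert (-A) t + μ) + ((w * (1 + 2 * A) : ℝ) : ℂ) := by
  simp only [vert]; push_cast; ring

theorem pow_mul_Gamma_isBigO {w A : ℝ} (hw : 0 < w) (hA : 0 < A) (μ : ℂ) :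
    (fun t : ℝ => (t : ℂ) ^ ⌊w * (1 + 2 * A)⌋₊ * Gamma (w * vert (-A) t + μ)) =O[cobounded ℝ]
      fun t => Gamma (w * vert (1 + A) t + μ) := by
  obtain ⟨C, hC⟩ := pow_floor_mul_Gamma_le (x := w * -A + μ.re) (a := w * (1 + 2 * A))
    (by positivity)
  have h1 : (fun t : ℝ => ((w * t + μ.im : ℝ) : ℂ) ^ ⌊w * (1 + 2 * A)⌋₊ *
      Gamma (w * vert (-A) t + μ)) =O[cobounded ℝ] fun t => Gamma (w * vert (1 + A) t + μ) := by
    refine IsBigO.of_bound C ?_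
    filter_upwards [eventually_one_le_abs_affine hw.ne' μ.im] with t ht
    have := hC (w * vert (-A) t + μ) (affine_vert_re _ _ _ _) (by rw [affine_vert_im]; exact ht)
    rw [affine_vert_im] at this
    rw [affine_vert_shift, norm_mul, norm_pow, Complex.norm_real]
    exact this
  refine IsBigO.trans (IsBigO.mul (IsBigO.pow ?_ _) (isBigO_refl _ _)) h1
  refine IsBigO.of_norm_norm ?_
  simp only [Complex.norm_real]
  exact (isBigO_id_affine hw.ne' μ.im).norm_norm

theorem Gamma_isBigO_pow_mul {w A : ℝ} (hw : 0 < w) (μ : ℂ) :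
    (fun t => Gamma (w * vert (1 + A) t + μ)) =O[cobounded ℝ]
      (fun t : ℝ => (t : ℂ) ^ ⌈w * (1 + 2 * A)⌉₊ * Gamma (w * vert (-A) t + μ)) := by
  obtain ⟨C, hC⟩ := norm_Gamma_add_le_pow_ceil (x := w * -A + μ.re) (a := w * (1 + 2 * A))
  have h1 : (fun t => Gamma (w * vert (1 + A) t + μ)) =O[cobounded ℝ]
      (fun t : ℝ => ((w * t + μ.im : ℝ) : ℂ) ^ ⌈w * (1 + 2 * A)⌉₊ *
        Gamma (w * vert (-A) t + μ)) := by
    refine IsBigO.of_bound C ?_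
    filter_upwards [eventually_one_le_abs_affine hw.ne' μ.im] with t ht
    have := hC (w * vert (-A) t + μ) (affine_vert_re _ _ _ _) (by rw [affine_vert_im]; exact ht)
    rw [affine_vert_im] at this
    rw [affine_vert_shift, norm_mul, norm_pow, Complex.norm_real]
    exact this
  refine h1.trans (IsBigO.mul (IsBigO.pow ?_ _) (isBigO_refl _ _))
  refine IsBigO.of_norm_norm ?_
  simp only [Complex.norm_real]
  exact (isBigO_affine_id μ.im).norm_norm

theorem norm_cpow_vert {Q : ℝ} (hQ : 0 < Q) (σ t : ℝ) : ‖(Q : ℂ) ^ vert σ t‖ = Q ^ σ := by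
  rw [norm_cpow_eq_rpow_re_of_pos hQ, vert_re]

section GammaFactor

variable {ε : ℂ} {Q : ℝ} {k : ℕ} {w : Fin k → ℝ} {μ : Fin k → ℂ}

theorem pow_mul_gammaFactor_isBigO (hε : ‖ε‖ = 1) (hQ : 0 < Q) (hw : ∀ i, 0 < w i) {A : ℝ}
    (hA : 0 < A) :
    (fun t : ℝ => (t : ℂ) ^ (∑ i, ⌊w i * (1 + 2 * A)⌋₊) * gammaFactor ε Q w μ (vert (-A) t))
      =O[cobounded ℝ] fun t => gammaFactor ε Q w μ (vert (1 + A) t) := by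
  have h1 := IsBigO.finsetProd (s := Finset.univ)
    fun i _ => pow_mul_Gamma_isBigO (hw i) hA (μ i)
  have h2 : (fun t : ℝ => ε * (Q : ℂ) ^ vert (-A) t) =O[cobounded ℝ]
      fun t : ℝ => ε * (Q : ℂ) ^ vert (1 + A) t := by
    refine IsBigO.of_bound (Q ^ (-A) / Q ^ (1 + A)) (Eventually.of_forall fun t => ?_)
    rw [norm_mul, norm_mul, norm_cpow_vert hQ, norm_cpow_vert hQ, hε, one_mul, one_mul,
      div_mul_cancel₀ _ (by positivity)]
  refine (h2.mul h1).congr_left fun t => ?_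
  rw [Finset.prod_mul_distrib, Finset.prod_pow_eq_pow_sum, gammaFactor]
  ring

theorem gammaFactor_isBigO_pow_mul (hε : ‖ε‖ = 1) (hQ : 0 < Q) (hw : ∀ i, 0 < w i) {A : ℝ} :
    (fun t => gammaFactor ε Q w μ (vert (1 + A) t)) =O[cobounded ℝ]
    (fun t : ℝ => (t : ℂ) ^ (∑ i, ⌈w i * (1 + 2 * A)⌉₊) * gammaFactor ε Q w μ (vert (-A) t)) := by
  have h1 := IsBigO.finsetProd (s := Finset.univ)
    fun i _ => Gamma_isBigO_pow_mul (A := A) (hw i) (μ i)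
  have h2 : (fun t : ℝ => ε * (Q : ℂ) ^ vert (1 + A) t) =O[cobounded ℝ]
      fun t : ℝ => ε * (Q : ℂ) ^ vert (-A) t := by
    refine IsBigO.of_bound (Q ^ (1 + A) / Q ^ (-A)) (Eventually.of_forall fun t => ?_)
    rw [norm_mul, norm_mul, norm_cpow_vert hQ, norm_cpow_vert hQ, hε, one_mul, one_mul,
      div_mul_cancel₀ _ (by positivity)]
  refine (h2.mul h1).congr_right fun t => ?_
  rw [Finset.prod_mul_distrib, Finset.prod_pow_eq_pow_sum, gammaFactor]
  ring

theorem eventually_gammaRegularAt (hw : ∀ i, 0 < w i) (σ : ℝ) :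
    ∀ᶠ t in cobounded ℝ, GammaRegularAt w μ (vert σ t) := by
  have h : ∀ᶠ t in cobounded ℝ, ∀ i, 1 ≤ |w i * t + (μ i).im| :=
    eventually_all.2 fun i => eventually_one_le_abs_affine (hw i).ne' _
  filter_upwards [h] with t ht i n hn
  have h1 := congrArg Complex.im hn
  rw [affine_vert_im] at h1
  have h2 := ht i
  rw [h1] at h2
  norm_num at h2

theorem gammaFactor_ne_zero (hε : ‖ε‖ = 1) (hQ : 0 < Q) {s : ℂ} (hs : GammaRegularAt w μ s) :
    gammaFactor ε Q w μ s ≠ 0 := by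
  have h1 : ε ≠ 0 := by
    rintro rfl
    simp at hε
  refine mul_ne_zero (mul_ne_zero h1 ?_) (Finset.prod_ne_zero_iff.2 fun i _ => ?_)
  · rw [Ne, cpow_eq_zero_iff, not_and_or]
    exact Or.inl (by exact_mod_cast hQ.ne')
  · exact Gamma_ne_zero fun n => hs i n

end GammaFactor

/-- The functional equation of `F` with the given data. -/
def SatisfiesFE (F : ℂ → ℂ) (ε : ℂ) (Q : ℝ) {k : ℕ} (w : Fin k → ℝ) (μ : Fin k → ℂ) : Prop :=
  ‖ε‖ = 1 ∧ 0 < Q ∧ (∀ i, 0 < w i) ∧ (∀ i, 0 ≤ (μ i).re) ∧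
    ∀ s : ℂ, s ≠ 0 → s ≠ 1 →
      GammaRegularAt w μ s → GammaRegularAt w μ (1 - starRingEnd ℂ s) →
      gammaFactor ε Q w μ s * F s =
        starRingEnd ℂ (gammaFactor ε Q w μ (1 - starRingEnd ℂ s) * F (1 - starRingEnd ℂ s))

/-! ### Growth on the left from the functional equation -/

section FE

variable {F : ℂ → ℂ} {ε : ℂ} {Q : ℝ} {k : ℕ} {w : Fin k → ℝ} {μ : Fin k → ℂ}

theorem SatisfiesFE.eventually_norm (h : SatisfiesFE F ε Q w μ) (σ : ℝ) :
    ∀ᶠ t in cobounded ℝ, gammaFactor ε Q w μ (vert σ t) ≠ 0 ∧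
      ‖gammaFactor ε Q w μ (vert σ t)‖ * ‖F (vert σ t)‖ =
        ‖gammaFactor ε Q w μ (vert (1 - σ) t)‖ * ‖F (vert (1 - σ) t)‖ := by
  obtain ⟨hε, hQ, hw, -, hFE⟩ := h
  filter_upwards [eventually_gammaRegularAt (μ := μ) hw σ,
    eventually_gammaRegularAt (μ := μ) hw (1 - σ),
    tendsto_norm_cobounded_atTop.eventually_ge_atTop 1] with t h1 h2 ht
  have him : 1 ≤ |(vert σ t).im| := by simpa using ht
  refine ⟨gammaFactor_ne_zero hε hQ h1, ?_⟩
  have h3 := hFE (vert σ t) (ne_zero_of_one_le_abs_im him) ?_ h1 (by rwa [one_sub_conj_vert])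
  · have := congrArg norm h3
    rwa [norm_mul, Complex.norm_conj, norm_mul, one_sub_conj_vert] at this
  · intro h4
    rw [h4] at him
    norm_num at him

/-- The lines `-A` and `1 + A` are exchanged by `s ↦ 1 - conj s`, so the ratio of gamma factors on
them is the ratio of the values of `F`. A lower bound for `F` on the right becomes growth on the
left. -/
theorem SatisfiesFE.pow_isBigO (h : SatisfiesFE F ε Q w μ) {A : ℝ} (hA : 0 < A)
    (hF : (fun _ : ℝ => (1 : ℝ)) =O[cobounded ℝ] fun t => F (vert (1 + A) t)) :
    (fun t : ℝ => t ^ (∑ i, ⌊w i * (1 + 2 * A)⌋₊)) =O[cobounded ℝ] fun t => F (vert (-A) t) := by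
  have h1 := (pow_mul_gammaFactor_isBigO (μ := μ) h.1 h.2.1 h.2.2.1 hA).norm_norm.mul hF.norm_norm
  obtain ⟨C, hC⟩ := h1.bound
  refine IsBigO.of_bound C ?_
  filter_upwards [hC, h.eventually_norm (-A)] with t ht ⟨ht0, ht1⟩
  rw [sub_neg_eq_add] at ht1
  simp only [norm_mul, norm_one, norm_norm, mul_one, norm_pow, Complex.norm_real] at ht
  rw [← ht1] at ht
  rw [norm_pow]
  have hpos := norm_pos_iff.2 ht0
  refine le_of_mul_le_mul_right (ht.trans (le_of_eq ?_)) hpos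
  ring

theorem SatisfiesFE.isBigO_pow (h : SatisfiesFE F ε Q w μ) {A : ℝ}
    (hF : (fun t => F (vert (1 + A) t)) =O[cobounded ℝ] (fun _ : ℝ => (1 : ℝ))) :
    (fun t => F (vert (-A) t)) =O[cobounded ℝ]
      (fun t : ℝ => t ^ (∑ i, ⌈w i * (1 + 2 * A)⌉₊)) := by
  have h1 := (gammaFactor_isBigO_pow_mul (A := A) (μ := μ) h.1 h.2.1 h.2.2.1).norm_norm.mul
    hF.norm_norm
  obtain ⟨C, hC⟩ := h1.bound
  refine IsBigO.of_bound C ?_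
  filter_upwards [hC, h.eventually_norm (-A)] with t ht ⟨ht0, ht1⟩
  rw [sub_neg_eq_add] at ht1
  simp only [norm_mul, norm_one, norm_norm, mul_one, norm_pow, Complex.norm_real] at ht
  rw [← ht1] at ht
  rw [norm_pow]
  have hpos := norm_pos_iff.2 ht0
  refine le_of_mul_le_mul_left (ht.trans (le_of_eq ?_)) hpos
  ring

end FE

theorem le_of_pow_isBigO_pow {m n : ℕ}
    (h : (fun t : ℝ => t ^ m) =O[cobounded ℝ] fun t : ℝ => t ^ n) : m ≤ n := by
  by_contra! hlt
  have h1 : (fun t : ℝ => t ^ n) =o[cobounded ℝ] fun t : ℝ => t ^ m :=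
    isLittleO_pow_pow_cobounded_of_lt hlt
  have h2 := h.trans_isLittleO h1
  have h3 := (isLittleO_irrefl' (l := cobounded ℝ) (f' := fun t : ℝ => t ^ m) ?_)
  · exact h3 h2
  · refine Eventually.frequently ?_
    filter_upwards [tendsto_norm_cobounded_atTop.eventually_ge_atTop 1] with t ht
    rw [norm_pow]
    have : 0 < ‖t‖ := by linarith
    positivity

theorem sum_floor_ge {k : ℕ} (w : Fin k → ℝ) (B : ℝ) :
    (∑ i, w i) * B - k ≤ ((∑ i, ⌊w i * B⌋₊ : ℕ) : ℝ) := by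
  push_cast
  have : ∑ i : Fin k, (w i * B - 1) ≤ ∑ i, (⌊w i * B⌋₊ : ℝ) :=
    Finset.sum_le_sum fun i _ => (Nat.sub_one_lt_floor _).le
  simpa [Finset.sum_sub_distrib, Finset.sum_mul] using this

theorem sum_ceil_le {k : ℕ} {w : Fin k → ℝ} (hw : ∀ i, 0 < w i) {B : ℝ} (hB : 0 ≤ B) :
    ((∑ i, ⌈w i * B⌉₊ : ℕ) : ℝ) ≤ (∑ i, w i) * B + k := by
  push_cast
  have : ∑ i, (⌈w i * B⌉₊ : ℝ) ≤ ∑ i : Fin k, (w i * B + 1) :=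
    Finset.sum_le_sum fun i _ => (Nat.ceil_lt_add_one (mul_nonneg (hw i).le hB)).le
  simpa [Finset.sum_add_distrib, Finset.sum_mul] using this

end Selberg

/-! ### Gaussian means over vertical lines and coefficient extraction -/

namespace Selberg

open Complex Bornology Topology MeasureTheory

/-- With `u = log (N / n)` this is approximate orthogonality of the `n ^ (-s)`: the value peaks at
`n = N` and carries the factor `exp(-u² / (4 ε))` otherwise, independently of `σ`. -/
theorem integral_cexp_vert {ε : ℝ} (hε : 0 < ε) (u σ : ℝ) :
    ∫ t : ℝ, cexp (u * vert σ t + ε * vert σ t ^ 2) =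
      ((√(Real.pi / ε) * Real.exp (-u ^ 2 / (4 * ε)) : ℝ) : ℂ) := by
  have h := fourierIntegral_gaussian (b := ε) (by simpa using hε) (u + 2 * ε * σ)
  have h1 : ∀ t : ℝ, cexp (u * vert σ t + ε * vert σ t ^ 2) =
      cexp (u * σ + ε * σ ^ 2) *
        (cexp (I * (u + 2 * ε * σ) * t) * cexp (-ε * t ^ 2)) := by
    intro t
    rw [← Complex.exp_add, ← Complex.exp_add]
    congr 1
    simp only [vert]
    linear_combination (ε * (t : ℂ) ^ 2) * I_sq
  simp_rw [h1]
  rw [integral_const_mul, h]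
  have h2 : ((Real.pi : ℂ) / ε) ^ (1 / 2 : ℂ) = (√(Real.pi / ε) : ℝ) := by
    rw [Real.sqrt_eq_rpow, Complex.ofReal_cpow (by positivity)]
    push_cast
    rfl
  rw [h2, mul_left_comm, ← Complex.exp_add]
  push_cast
  congr 2
  have : (ε : ℂ) ≠ 0 := by exact_mod_cast hε.ne'
  field_simp
  ring

theorem tendsto_exp_neg_sq_cobounded {b : ℝ} (hb : 0 < b) :
    Tendsto (fun t : ℝ => Real.exp (-b * t ^ 2)) (cobounded ℝ) (𝓝 0) := by
  have h1 : Tendsto (fun t : ℝ => b * ‖t‖ ^ 2) (cobounded ℝ) atTop :=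
    ((tendsto_pow_atTop two_ne_zero).comp tendsto_norm_cobounded_atTop).const_mul_atTop hb
  refine (Real.tendsto_exp_neg_atTop_nhds_zero.comp h1).congr fun t => ?_
  simp

/-- A vertical line integral of an entire function with Gaussian decay in a strip does not depend on
the line. -/
theorem integral_vert_eq {f : ℂ → ℂ} (hf : Differentiable ℂ f) {a b : ℝ} (hab : a ≤ b) {C β : ℝ}
    (hβ : 0 < β) (hC : ∀ σ t : ℝ, a ≤ σ → σ ≤ b → ‖f (vert σ t)‖ ≤ C * Real.exp (-β * t ^ 2)) :
    ∫ t : ℝ, f (vert a t) = ∫ t : ℝ, f (vert b t) := by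
  have hcont : ∀ σ, Continuous fun t : ℝ => f (vert σ t) := fun σ =>
    hf.continuous.comp (by unfold vert; fun_prop)
  have hint : ∀ σ, a ≤ σ → σ ≤ b → Integrable fun t : ℝ => f (vert σ t) := fun σ h1 h2 =>
    ((integrable_exp_neg_mul_sq hβ).const_mul C).mono' (hcont σ).aestronglyMeasurable
      (Eventually.of_forall fun t => hC σ t h1 h2)
  have hlim : ∀ σ, a ≤ σ → σ ≤ b →
      Tendsto (fun T : ℝ => ∫ t in (-T)..T, f (vert σ t)) atTop (𝓝 (∫ t, f (vert σ t))) :=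
    fun σ h1 h2 => intervalIntegral_tendsto_integral (hint σ h1 h2) tendsto_neg_atTop_atBot
      tendsto_id
  have hside : ∀ φ : ℝ → ℝ, Tendsto φ atTop (cobounded ℝ) →
      Tendsto (fun T : ℝ => ∫ x in a..b, f (vert x (φ T))) atTop (𝓝 0) := by
    intro φ hφ
    have h1 : Tendsto (fun T => C * Real.exp (-β * φ T ^ 2) * |b - a|) atTop (𝓝 0) := by
      simpa using (((tendsto_exp_neg_sq_cobounded hβ).comp hφ).const_mul C).mul_const |b - a|
    refine squeeze_zero_norm (fun T => ?_) h1
    refine intervalIntegral.norm_integral_le_of_norm_le_const fun x hx => ?_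
    rw [Set.uIoc_of_le hab] at hx
    exact hC x _ hx.1.le hx.2
  have hrect : ∀ T : ℝ, ((∫ x in a..b, f (vert x (-T))) - ∫ x in a..b, f (vert x T)) +
      I * (∫ t in (-T)..T, f (vert b t)) - I * (∫ t in (-T)..T, f (vert a t)) = 0 := by
    intro T
    have := integral_boundary_rect_eq_zero_of_differentiableOn f ⟨a, -T⟩ ⟨b, T⟩ hf.differentiableOn
    simpa [vert, smul_eq_mul] using this
  have hcob : Tendsto (fun T : ℝ => T) atTop (cobounded ℝ) :=
    tendsto_norm_atTop_iff_cobounded.1 tendsto_abs_atTop_atTop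
  have hcob' : Tendsto (fun T : ℝ => -T) atTop (cobounded ℝ) :=
    tendsto_norm_atTop_iff_cobounded.1 (by simpa using tendsto_abs_atTop_atTop)
  have h := ((((hside _ hcob').sub (hside _ hcob)).add
    ((hlim b hab le_rfl).const_mul I)).sub ((hlim a le_rfl hab).const_mul I))
  simp_rw [hrect] at h
  have h2 := tendsto_nhds_unique h tendsto_const_nhds
  have h3 : I * ((∫ t : ℝ, f (vert b t)) - ∫ t : ℝ, f (vert a t)) = 0 := by
    linear_combination h2
  rcases mul_eq_zero.1 h3 with h4 | h4
  · exact absurd h4 I_ne_zero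
  · exact (sub_eq_zero.1 h4).symm

/-- Half of the Gaussian absorbs the polynomial, by `y ^ e / e! ≤ exp y` at `y = (1 + ε t²) / 2`.
The price `ε ^ (-e)` later determines how small the half-degree must be. -/
theorem one_add_sq_pow_mul_exp_le {ε : ℝ} (hε : 0 < ε) (hε1 : ε ≤ 1) (e : ℕ) (t : ℝ) :
    (1 + t ^ 2) ^ e * Real.exp (-ε * t ^ 2) ≤
      (e.factorial * 2 ^ e * Real.exp (1 / 2)) / ε ^ e * Real.exp (-(ε / 2) * t ^ 2) := by
  have h1 : (1 + t ^ 2) ^ e ≤ ((1 + ε * t ^ 2) / ε) ^ e := by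
    gcongr
    rw [le_div_iff₀ hε]
    nlinarith [sq_nonneg t]
  have h2 := Real.pow_div_factorial_le_exp ((1 + ε * t ^ 2) / 2) (by positivity) e
  rw [div_le_iff₀ (by positivity), div_pow, div_le_iff₀ (by positivity)] at h2
  have h3 : Real.exp ((1 + ε * t ^ 2) / 2) * Real.exp (-ε * t ^ 2) =
      Real.exp (1 / 2) * Real.exp (-(ε / 2) * t ^ 2) := by
    rw [← Real.exp_add, ← Real.exp_add]
    congr 1
    ring
  calc (1 + t ^ 2) ^ e * Real.exp (-ε * t ^ 2)
      ≤ ((1 + ε * t ^ 2) ^ e / ε ^ e) * Real.exp (-ε * t ^ 2) := by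
        rw [← div_pow]; gcongr
    _ ≤ (Real.exp ((1 + ε * t ^ 2) / 2) * e.factorial * 2 ^ e / ε ^ e) *
          Real.exp (-ε * t ^ 2) := by gcongr
    _ = (e.factorial * 2 ^ e) / ε ^ e *
          (Real.exp ((1 + ε * t ^ 2) / 2) * Real.exp (-ε * t ^ 2)) := by ring
    _ = _ := by rw [h3]; ring

/-- The Gaussian-weighted function whose integral over a vertical line isolates the coefficient of
index `N`. -/
noncomputable def gaussWeight (F : ℂ → ℂ) (N : ℕ) (ε : ℝ) (s : ℂ) : ℂ :=
  F s * ((N : ℂ) ^ s * cexp (ε * s ^ 2))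

theorem norm_natCast_cpow_vert {N : ℕ} (hN : 0 < N) (σ t : ℝ) :
    ‖(N : ℂ) ^ vert σ t‖ = (N : ℝ) ^ σ := by
  rw [norm_natCast_cpow_of_pos hN, vert_re]

theorem norm_cexp_sq_vert (ε σ t : ℝ) :
    ‖cexp (ε * vert σ t ^ 2)‖ = Real.exp (ε * σ ^ 2) * Real.exp (-ε * t ^ 2) := by
  rw [Complex.norm_exp, ← Real.exp_add]
  congr 1
  simp [vert, sq]
  ring

theorem norm_gaussWeight (F : ℂ → ℂ) {N : ℕ} (hN : 0 < N) (ε σ t : ℝ) :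
    ‖gaussWeight F N ε (vert σ t)‖ = (N : ℝ) ^ σ * Real.exp (ε * σ ^ 2) *
      (‖F (vert σ t)‖ * Real.exp (-ε * t ^ 2)) := by
  rw [gaussWeight, norm_mul, norm_mul, norm_natCast_cpow_vert hN, norm_cexp_sq_vert]
  ring

theorem integral_gaussWeight_eq {F : ℂ → ℂ} (hF : Differentiable ℂ F) {a b : ℝ} (hab : a ≤ b)
    {C : ℝ} {e : ℕ}
    (hC : ∀ σ t : ℝ, a ≤ σ → σ ≤ b → ‖F (vert σ t)‖ ≤ C * (1 + t ^ 2) ^ e) {N : ℕ} (hN : 0 < N)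
    {ε : ℝ} (hε : 0 < ε) (hε1 : ε ≤ 1) :
    ∫ t : ℝ, gaussWeight F N ε (vert a t) = ∫ t : ℝ, gaussWeight F N ε (vert b t) := by
  have hN1 : (1 : ℝ) ≤ N := by exact_mod_cast hN
  have hC0 : 0 ≤ C := by
    have := (norm_nonneg _).trans (hC a 0 le_rfl hab)
    simpa using this
  have hd : Differentiable ℂ (gaussWeight F N ε) := by
    intro s
    unfold gaussWeight
    refine (hF s).mul (DifferentiableAt.mul ?_ (by fun_prop))
    exact DifferentiableAt.const_cpow differentiableAt_id (Or.inl (by exact_mod_cast hN.ne'))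
  refine integral_vert_eq hd hab (half_pos hε)
    (C := ((N : ℝ) ^ b * Real.exp (ε * (a ^ 2 + b ^ 2))) *
      (C * ((e.factorial * 2 ^ e * Real.exp (1 / 2)) / ε ^ e))) fun σ t h1 h2 => ?_
  rw [norm_gaussWeight F hN, mul_assoc]
  have h4 : σ ^ 2 ≤ a ^ 2 + b ^ 2 := by
    rcases le_total 0 σ with h | h <;> nlinarith [sq_nonneg a, sq_nonneg b]
  have h5 : ‖F (vert σ t)‖ * Real.exp (-ε * t ^ 2) ≤
      (C * ((e.factorial * 2 ^ e * Real.exp (1 / 2)) / ε ^ e)) *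
        Real.exp (-(ε / 2) * t ^ 2) := by
    calc ‖F (vert σ t)‖ * Real.exp (-ε * t ^ 2)
        ≤ C * (1 + t ^ 2) ^ e * Real.exp (-ε * t ^ 2) := by gcongr; exact hC σ t h1 h2
      _ = C * ((1 + t ^ 2) ^ e * Real.exp (-ε * t ^ 2)) := by ring
      _ ≤ C * ((e.factorial * 2 ^ e * Real.exp (1 / 2)) / ε ^ e *
            Real.exp (-(ε / 2) * t ^ 2)) := by
          exact mul_le_mul_of_nonneg_left (one_add_sq_pow_mul_exp_le hε hε1 e t) hC0
      _ = _ := by ring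
  rw [← mul_assoc, mul_assoc (_ * _) (C * _)]
  gcongr

theorem half_div_le_abs_log_div {n N : ℕ} (hn : 0 < n) (hN : 0 < N) (h : n ≠ N) :
    1 / (2 * (N : ℝ)) ≤ |Real.log (N / n)| := by
  have hN1 : (1 : ℝ) ≤ N := by exact_mod_cast hN
  have hn1 : (1 : ℝ) ≤ n := by exact_mod_cast hn
  rcases lt_or_gt_of_ne h with h | h
  · have h1 : (n : ℝ) + 1 ≤ N := by exact_mod_cast h
    have h2 := Real.one_sub_inv_le_log_of_pos (x := (N : ℝ) / n) (by positivity)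
    rw [inv_div] at h2
    refine le_trans ?_ (h2.trans (le_abs_self _))
    rw [one_sub_div (by positivity), div_le_div_iff₀ (by positivity) (by positivity)]
    nlinarith
  · have h1 : (N : ℝ) + 1 ≤ n := by exact_mod_cast h
    have h2 := Real.one_sub_inv_le_log_of_pos (x := (n : ℝ) / N) (by positivity)
    rw [inv_div] at h2
    rw [← inv_div (n : ℝ), Real.log_inv, abs_neg]
    refine le_trans ?_ (h2.trans (le_abs_self _))
    rw [one_sub_div (by positivity), div_le_div_iff₀ (by positivity) (by positivity)]
    nlinarith

/-- The exponent is split into two equal halves. One, with `|log (N / n)| ≥ 1 / (2 N)`, gives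
smallness uniform in `n`; the other gives the factor `n ^ (-2)` needed for summation over `n`. -/
theorem exp_log_sq_le {n N : ℕ} (hn : 0 < n) (hN : 0 < N) (h : n ≠ N) {ε : ℝ} (hε : 0 < ε) :
    Real.exp (-(Real.log (N / n)) ^ 2 / (4 * ε)) ≤
      Real.exp (-1 / (32 * ε * N ^ 2)) * Real.exp (8 * ε) * ((N : ℝ) / n) ^ (2 : ℝ) := by
  have hN1 : (1 : ℝ) ≤ N := by exact_mod_cast hN
  have hn1 : (1 : ℝ) ≤ n := by exact_mod_cast hn
  rw [Real.rpow_def_of_pos (by positivity), ← Real.exp_add, ← Real.exp_add]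
  refine Real.exp_le_exp.2 ?_
  have h1 := half_div_le_abs_log_div hn hN h
  set u := Real.log ((N : ℝ) / n)
  have h2 : (1 / (2 * (N : ℝ))) ^ 2 ≤ u ^ 2 := by
    rw [← sq_abs u]
    gcongr
  have h3 : -1 / (32 * ε * N ^ 2) = -(1 / (2 * (N : ℝ))) ^ 2 / (8 * ε) := by
    field_simp
    ring
  have h4 : -u ^ 2 / (8 * ε) ≤ 8 * ε + u * 2 := by
    -- After clearing the denominator this is `(u + 8 ε)² ≥ 0`.
    rw [div_le_iff₀ (by positivity)]
    nlinarith [sq_nonneg (u + 8 * ε)]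
  have h5 : -u ^ 2 / (4 * ε) = -u ^ 2 / (8 * ε) + -u ^ 2 / (8 * ε) := by
    field_simp
    ring
  have h6 : -u ^ 2 / (8 * ε) ≤ -(1 / (2 * (N : ℝ))) ^ 2 / (8 * ε) := by gcongr
  rw [h3, h5]
  linarith

theorem integral_term_gaussWeight (c : ℕ → ℂ) {n N : ℕ} (hn : 0 < n) (hN : 0 < N) {ε : ℝ}
    (hε : 0 < ε) (σ : ℝ) :
    ∫ t : ℝ, gaussWeight (fun s => LSeries.term c s n) N ε (vert σ t) =
      c n * ((√(Real.pi / ε) * Real.exp (-(Real.log (N / n)) ^ 2 / (4 * ε)) : ℝ) : ℂ) := by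
  rw [← integral_cexp_vert hε _ σ, ← integral_const_mul]
  refine integral_congr_ae (Eventually.of_forall fun t => ?_)
  have hn' : (n : ℂ) ≠ 0 := by exact_mod_cast hn.ne'
  have hN' : (N : ℂ) ≠ 0 := by exact_mod_cast hN.ne'
  simp only [gaussWeight]
  rw [LSeries.term_of_ne_zero hn.ne', cpow_def_of_ne_zero hn', cpow_def_of_ne_zero hN',
    Complex.exp_add, Real.log_div (by exact_mod_cast hN.ne') (by exact_mod_cast hn.ne'),
    ← natCast_log, ← natCast_log, Complex.ofReal_sub, sub_mul, Complex.exp_sub]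
  field_simp

/-- The Gaussian mean of `F(s) N^s` over a vertical line bounds the coefficient of index `N`. -/
theorem norm_coeff_le_of_line_two {c : ℕ → ℂ} (hs : LSeriesSummable c 2) {N : ℕ} (hN : 0 < N)
    {ε : ℝ} (hε : 0 < ε) :
    ‖c N‖ ≤ Real.exp (-1 / (32 * ε * N ^ 2)) * Real.exp (8 * ε) * (N : ℝ) ^ (2 : ℝ) *
        (∑' n, ‖LSeries.term c 2 n‖) +
      ‖∫ t : ℝ, gaussWeight (LSeries c) N ε (vert 2 t)‖ / √(Real.pi / ε) := by
  set G : ℕ → ℝ → ℂ := fun n t => gaussWeight (fun s => LSeries.term c s n) N ε (vert 2 t) with hG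
  have hnorm : ∀ n t, ‖G n t‖ = ((N : ℝ) ^ (2 : ℝ) * Real.exp (ε * 2 ^ 2) *
      ‖LSeries.term c 2 n‖) * Real.exp (-ε * t ^ 2) := by
    intro n t
    have h1 : ‖LSeries.term c (vert 2 t) n‖ = ‖LSeries.term c 2 n‖ := by
      rw [LSeries.norm_term_eq, LSeries.norm_term_eq, vert_re]
      simp
    simp only [hG]
    rw [norm_gaussWeight _ hN, h1, ← mul_assoc]
  have hcont : ∀ n, Continuous (G n) := by
    intro n
    have hv : Continuous fun t => vert 2 t := by unfold vert; fun_prop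
    simp only [hG, gaussWeight]
    refine Continuous.mul ?_ (Continuous.mul ?_ (by fun_prop))
    · rcases Nat.eq_zero_or_pos n with rfl | hn
      · simp [continuous_const]
      · simp_rw [LSeries.term_of_ne_zero hn.ne']
        have hn' : (n : ℂ) ≠ 0 := by exact_mod_cast hn.ne'
        refine continuous_const.div (hv.const_cpow (Or.inl hn')) fun t => ?_
        rw [Ne, cpow_eq_zero_iff]
        tauto
    · exact hv.const_cpow (Or.inl (by exact_mod_cast hN.ne'))
  have hint : ∀ n, Integrable (G n) := fun n =>
    ((integrable_exp_neg_mul_sq hε).const_mul _).mono' (hcont n).aestronglyMeasurable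
      (Eventually.of_forall fun t => (hnorm n t).le)
  have hsum : Summable fun n => ∫ t, ‖G n t‖ := by
    simp_rw [hnorm, integral_const_mul]
    exact (Summable.mul_left _ hs.norm).mul_right _
  have hasSum := hasSum_integral_of_summable_integral_norm hint hsum
  have htot : ∫ t, ∑' n, G n t = ∫ t : ℝ, gaussWeight (LSeries c) N ε (vert 2 t) := by
    refine integral_congr_ae (Eventually.of_forall fun t => ?_)
    simp only [hG, gaussWeight, LSeries]
    rw [tsum_mul_right]
  rw [htot] at hasSum
  set J := ∫ t : ℝ, gaussWeight (LSeries c) N ε (vert 2 t)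
  have hP : 0 < √(Real.pi / ε) := Real.sqrt_pos.2 (by positivity)
  set P := √(Real.pi / ε)
  set B := Real.exp (-1 / (32 * ε * N ^ 2)) * Real.exp (8 * ε) * (N : ℝ) ^ (2 : ℝ) with hB
  have hsplit := hasSum.summable.tsum_eq_add_tsum_ite N
  rw [hasSum.tsum_eq, show (∫ t, G N t) = c N * (P : ℂ) by
    have := integral_term_gaussWeight c hN hN hε 2
    rw [div_self (by exact_mod_cast hN.ne')] at this
    simpa using this] at hsplit
  have hoff : ‖∑' n, (if n = N then 0 else ∫ t, G n t)‖ ≤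
      P * B * ∑' n, ‖LSeries.term c 2 n‖ := by
    refine tsum_of_norm_bounded (hs.norm.hasSum.mul_left (P * B)) fun n => ?_
    split_ifs with hnN
    · rw [norm_zero]; positivity
    rcases Nat.eq_zero_or_pos n with rfl | hn
    · simp [hG, gaussWeight]
    · rw [show (∫ t, G n t) = _ from integral_term_gaussWeight c hn hN hε 2, norm_mul,
        Complex.norm_real, Real.norm_of_nonneg (by positivity), LSeries.norm_term_eq,
        if_neg hn.ne']
      have h1 := exp_log_sq_le hn hN hnN hε
      rw [Real.div_rpow (by positivity) (by positivity)] at h1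
      calc ‖c n‖ * (P * Real.exp (-(Real.log (N / n)) ^ 2 / (4 * ε)))
          ≤ ‖c n‖ * (P * (Real.exp (-1 / (32 * ε * N ^ 2)) * Real.exp (8 * ε) *
              ((N : ℝ) ^ (2 : ℝ) / (n : ℝ) ^ (2 : ℝ)))) := by gcongr
        _ = _ := by rw [hB]; simp only [re_ofNat]; ring
  have h1 : c N * (P : ℂ) = J - ∑' n, (if n = N then 0 else ∫ t, G n t) := by
    rw [hsplit]; ring
  have h2 : ‖c N‖ * P ≤ ‖J‖ + P * B * ∑' n, ‖LSeries.term c 2 n‖ := by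
    rw [← Real.norm_of_nonneg hP.le, ← Complex.norm_real P, ← norm_mul, h1, Complex.norm_real,
      Real.norm_of_nonneg hP.le]
    exact (norm_sub_le _ _).trans (by gcongr)
  rw [← mul_le_mul_iff_left₀ hP, add_mul, div_mul_cancel₀ _ hP.ne']
  linarith

/-- The coefficient of index `N` is bounded by a Gaussian mean of the continuation on a line to the
left. -/
theorem norm_coeff_le {c : ℕ → ℂ} {F : ℂ → ℂ} (hF : Differentiable ℂ F)
    (hs : LSeriesSummable c 2) (hFc : ∀ s : ℂ, 1 < s.re → F s = LSeries c s) {A : ℝ} (hA : 0 ≤ A)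
    {C : ℝ} {e : ℕ}
    (hC : ∀ σ t : ℝ, -A ≤ σ → σ ≤ 2 → ‖F (vert σ t)‖ ≤ C * (1 + t ^ 2) ^ e) {N : ℕ} (hN : 0 < N)
    {ε : ℝ} (hε : 0 < ε) (hε1 : ε ≤ 1) {b : ℕ} {D : ℝ}
    (hD : ∀ t : ℝ, ‖F (vert (-A) t)‖ ≤ D * (1 + t ^ 2) ^ b) :
    ‖c N‖ ≤ Real.exp (-1 / (32 * ε * N ^ 2)) * Real.exp (8 * ε) * (N : ℝ) ^ (2 : ℝ) *
        (∑' n, ‖LSeries.term c 2 n‖) +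
      (N : ℝ) ^ (-A) * Real.exp (ε * A ^ 2) *
        (D * ((b.factorial * 2 ^ b * Real.exp (1 / 2)) / ε ^ b) * √2) := by
  refine (norm_coeff_le_of_line_two hs hN hε).trans (add_le_add le_rfl ?_)
  have h1 : ∫ t : ℝ, gaussWeight (LSeries c) N ε (vert 2 t) =
      ∫ t : ℝ, gaussWeight F N ε (vert 2 t) := by
    refine integral_congr_ae (Eventually.of_forall fun t => ?_)
    simp only [gaussWeight]
    rw [hFc _ (by rw [vert_re]; norm_num)]
  have hP : 0 < √(Real.pi / ε) := Real.sqrt_pos.2 (by positivity)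
  -- The strip bound `C`, `e` only licenses the shift of the line; the estimate itself sees only `D`
  -- and `b` on the line `-A`.
  rw [h1, ← integral_gaussWeight_eq hF (by linarith) hC hN hε hε1, div_le_iff₀ hP]
  have hD0 : 0 ≤ D := by simpa using (norm_nonneg _).trans (hD 0)
  have h2 : ∀ t : ℝ, ‖gaussWeight F N ε (vert (-A) t)‖ ≤ (N : ℝ) ^ (-A) * Real.exp (ε * A ^ 2) *
      (D * ((b.factorial * 2 ^ b * Real.exp (1 / 2)) / ε ^ b)) *
        Real.exp (-(ε / 2) * t ^ 2) := by
    intro t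
    rw [norm_gaussWeight F hN, neg_sq, mul_assoc _ (D * _)]
    refine mul_le_mul_of_nonneg_left ?_ (by positivity)
    calc ‖F (vert (-A) t)‖ * Real.exp (-ε * t ^ 2)
        ≤ D * (1 + t ^ 2) ^ b * Real.exp (-ε * t ^ 2) := by gcongr; exact hD t
      _ = D * ((1 + t ^ 2) ^ b * Real.exp (-ε * t ^ 2)) := by ring
      _ ≤ D * ((b.factorial * 2 ^ b * Real.exp (1 / 2)) / ε ^ b *
            Real.exp (-(ε / 2) * t ^ 2)) := by
          exact mul_le_mul_of_nonneg_left (one_add_sq_pow_mul_exp_le hε hε1 b t) hD0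
      _ = _ := by ring
  refine (norm_integral_le_of_norm_le
    ((integrable_exp_neg_mul_sq (half_pos hε)).const_mul _) (Eventually.of_forall h2)).trans
    (le_of_eq ?_)
  rw [integral_const_mul, integral_gaussian,
    show Real.pi / (ε / 2) = 2 * (Real.pi / ε) by field_simp, Real.sqrt_mul (by norm_num)]
  ring

end Selberg

/-! ### The half-degree and polynomial growth in strips -/

namespace Selberg

open Complex Bornology Topology MeasureTheory

theorem continuous_vert (σ : ℝ) : Continuous (vert σ) := by unfold vert; fun_prop

theorem HasRamanujan.lseriesSummable {a : ArithmeticFunction ℂ} (ha : HasRamanujan a) {s : ℂ}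
    (hs : 1 < s.re) : LSeriesSummable a s := by
  refine LSeriesSummable_of_isBigO_rpow (x := (s.re + 1) / 2) (by linarith) ?_
  exact ha _ (by linarith)

theorem norm_LSeries_le {c : ℕ → ℂ} {s : ℂ} (h : LSeriesSummable c s) {s' : ℂ}
    (hs : s'.re = s.re) : ‖LSeries c s'‖ ≤ ∑' n, ‖LSeries.term c s n‖ := by
  refine tsum_of_norm_bounded h.norm.hasSum fun n => le_of_eq ?_
  rw [LSeries.norm_term_eq, LSeries.norm_term_eq, hs]

theorem LSeries_vert_isBigO_one {c : ℕ → ℂ} {σ : ℝ} (h : LSeriesSummable c σ) (l : Filter ℝ) :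
    (fun t => LSeries c (vert σ t)) =O[l] fun _ : ℝ => (1 : ℝ) := by
  refine IsBigO.of_bound (∑' n, ‖LSeries.term c σ n‖) (Eventually.of_forall fun t => ?_)
  simpa using norm_LSeries_le h (s' := vert σ t) (by simp)

/-- The series for `log F` is bounded by `K` on the line, and `|exp L| = exp (Re L) ≥ exp (-K)`. -/
theorem HasEulerProduct.one_isBigO {a : ArithmeticFunction ℂ} (ha : HasEulerProduct a) {σ : ℝ}
    (hσ : 1 < σ) (l : Filter ℝ) :
    (fun _ : ℝ => (1 : ℝ)) =O[l] fun t => LSeries a (vert σ t) := by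
  obtain ⟨-, b, -, -, -, -, hb⟩ := ha
  set K := ∑' n, ‖LSeries.term b σ n‖ with hK
  refine IsBigO.of_bound (Real.exp K) (Eventually.of_forall fun t => ?_)
  have h1 := norm_LSeries_le (hb σ (by simpa using hσ)).1 (s' := vert σ t) (by simp)
  rw [← (hb (vert σ t) (by simpa using hσ)).2, Complex.norm_exp, ← Real.exp_add, norm_one,
    ← Real.exp_zero]
  refine Real.exp_le_exp.2 ?_
  have := (abs_re_le_norm (LSeries b (vert σ t))).trans h1
  linarith [(abs_le.1 this).1]

theorem eq_of_eq_on_re_gt_one {f g : ℂ → ℂ} (hf : Differentiable ℂ f) (hg : Differentiable ℂ g)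
    (h : ∀ s : ℂ, 1 < s.re → f s = g s) : f = g := by
  refine AnalyticOnNhd.eq_of_eventuallyEq (analyticOnNhd_univ_iff_differentiable.2 hf)
    (analyticOnNhd_univ_iff_differentiable.2 hg) (z₀ := 2) ?_
  have h1 : {s : ℂ | 1 < s.re} ∈ 𝓝 (2 : ℂ) :=
    (isOpen_lt continuous_const continuous_re).mem_nhds (by simp)
  exact eventually_of_mem h1 h

theorem ne_one_of_one_lt_re {s : ℂ} (hs : 1 < s.re) : s ≠ 1 := by
  rintro rfl
  simp at hs

theorem HasAnalyticity.eq_off_one {a : ArithmeticFunction ℂ} {F F' : ℂ → ℂ}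
    (h : HasAnalyticity a F) (h' : HasAnalyticity a F') {s : ℂ} (hs : s ≠ 1) : F s = F' s := by
  obtain ⟨h1, m, G, hG, -, hGF⟩ := h
  obtain ⟨h1', m', G', hG', -, hGF'⟩ := h'
  have key : (fun s => (s - 1) ^ m' * G s) = fun s => (s - 1) ^ m * G' s := by
    refine eq_of_eq_on_re_gt_one (by fun_prop) (by fun_prop) fun s hs => ?_
    have hs1 := ne_one_of_one_lt_re hs
    rw [hGF s hs1, hGF' s hs1, h1 s hs, h1' s hs]
    ring
  have h2 := congrFun key s
  simp only [hGF s hs, hGF' s hs] at h2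
  have h3 : (s - 1) ^ (m + m') ≠ 0 := pow_ne_zero _ (sub_ne_zero.2 hs)
  refine mul_left_cancel₀ h3 ?_
  rw [pow_add]
  linear_combination h2

/-- `F` satisfies the first and third axioms of the Selberg class with `∑ wᵢ = W`, half the
degree. -/
def HasHalfDegree (a : ArithmeticFunction ℂ) (W : ℝ) : Prop :=
  ∃ F : ℂ → ℂ, HasAnalyticity a F ∧
    ∃ (ε : ℂ) (Q : ℝ) (k : ℕ) (w : Fin k → ℝ) (μ : Fin k → ℂ), SatisfiesFE F ε Q w μ ∧ ∑ i, w i = W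

theorem exists_hasHalfDegree {a : ArithmeticFunction ℂ} (ha : a ∈ SelbergClass) :
    ∃ W, HasHalfDegree a W := by
  obtain ⟨⟨F, hF, ε, Q, k, w, μ, h⟩, -⟩ := ha
  exact ⟨_, F, hF, ε, Q, k, w, μ, h, rfl⟩

theorem HasAnalyticity.vert_isBigO_one {a : ArithmeticFunction ℂ} {F : ℂ → ℂ}
    (hF : HasAnalyticity a F) (hr : HasRamanujan a) {σ : ℝ} (hσ : 1 < σ) :
    (fun t => F (vert σ t)) =O[cobounded ℝ] fun _ : ℝ => (1 : ℝ) :=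
  (LSeries_vert_isBigO_one (hr.lseriesSummable (by simpa using hσ)) _).congr_left
    fun t => (hF.1 _ (by simpa using hσ)).symm

theorem HasAnalyticity.one_isBigO_vert {a : ArithmeticFunction ℂ} {F : ℂ → ℂ}
    (hF : HasAnalyticity a F) (he : HasEulerProduct a) {σ : ℝ} (hσ : 1 < σ) :
    (fun _ : ℝ => (1 : ℝ)) =O[cobounded ℝ] fun t => F (vert σ t) :=
  (he.one_isBigO hσ _).congr_right fun t => (hF.1 _ (by simpa using hσ)).symm

/-- Two sets of gamma data give a lower and an upper bound for the same function on `Re s = -A`. The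
exponents are `W (1 + 2A)` and `W' (1 + 2A)` up to errors at most `k` and `k'`, so a large `A`
forces `W ≤ W'`. -/
theorem HasHalfDegree.le {a : ArithmeticFunction ℂ} (hr : HasRamanujan a)
    (he : HasEulerProduct a) {W W' : ℝ} (h : HasHalfDegree a W) (h' : HasHalfDegree a W') :
    W ≤ W' := by
  obtain ⟨F, hF, ε, Q, k, w, μ, hFE, rfl⟩ := h
  obtain ⟨F', hF', ε', Q', k', w', μ', hFE', rfl⟩ := h'
  have key : ∀ A : ℝ, 0 < A →
      (∑ i, w i) * (1 + 2 * A) - k ≤ (∑ i, w' i) * (1 + 2 * A) + k' := by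
    intro A hA
    have h1 := hFE.pow_isBigO hA (hF.one_isBigO_vert he (by linarith))
    have h2 := hFE'.isBigO_pow (hF'.vert_isBigO_one hr (σ := 1 + A) (by linarith))
    have h3 : (fun t => F (vert (-A) t)) = fun t => F' (vert (-A) t) := by
      funext t
      refine hF.eq_off_one hF' fun h => ?_
      have := congrArg re h
      simp at this
      linarith
    rw [h3] at h1
    have h4 : ((∑ i, ⌊w i * (1 + 2 * A)⌋₊ : ℕ) : ℝ) ≤ ((∑ i, ⌈w' i * (1 + 2 * A)⌉₊ : ℕ) : ℝ) := by
      exact_mod_cast le_of_pow_isBigO_pow (h1.trans h2)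
    exact (sum_floor_ge w _).trans (h4.trans (sum_ceil_le hFE'.2.2.1 (by linarith)))
  by_contra! hlt
  have hd := sub_pos.2 hlt
  have h5 := key (((k : ℝ) + k' + 1) / (∑ i, w i - ∑ i, w' i)) (by positivity)
  have h6 : (∑ i, w i - ∑ i, w' i) * (((k : ℝ) + k' + 1) / (∑ i, w i - ∑ i, w' i)) = k + k' + 1 :=
    mul_div_cancel₀ _ hd.ne'
  nlinarith [Nat.cast_nonneg (α := ℝ) k, Nat.cast_nonneg (α := ℝ) k']

theorem finiteOrder_mul {G G' : ℂ → ℂ} {ρ ρ' : ℝ}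
    (h : G =O[cobounded ℂ] fun s => Real.exp (‖s‖ ^ ρ))
    (h' : G' =O[cobounded ℂ] fun s => Real.exp (‖s‖ ^ ρ')) :
    (fun s => G s * G' s) =O[cobounded ℂ] fun s => Real.exp (‖s‖ ^ (max ρ ρ' + 1)) := by
  refine (h.mul h').trans (IsBigO.of_bound 1 ?_)
  filter_upwards [tendsto_norm_cobounded_atTop.eventually_ge_atTop 2] with s hs
  have hs1 : 1 ≤ ‖s‖ := by linarith
  -- The extra `1` in the exponent absorbs the sum of the two powers, because `‖s‖ ≥ 2`.
  rw [← Real.exp_add, Real.norm_of_nonneg (Real.exp_pos _).le,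
    Real.norm_of_nonneg (Real.exp_pos _).le, one_mul]
  refine Real.exp_le_exp.2 ?_
  have h1 : ‖s‖ ^ ρ ≤ ‖s‖ ^ (max ρ ρ') := Real.rpow_le_rpow_of_exponent_le hs1 (le_max_left _ _)
  have h2 : ‖s‖ ^ ρ' ≤ ‖s‖ ^ (max ρ ρ') := Real.rpow_le_rpow_of_exponent_le hs1 (le_max_right _ _)
  rw [Real.rpow_add_one (by linarith)]
  have h3 : 0 ≤ ‖s‖ ^ (max ρ ρ') := by positivity
  nlinarith

theorem HasHalfDegree.mul {a b : ArithmeticFunction ℂ} (ha : HasRamanujan a)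
    (hb : HasRamanujan b) {V W : ℝ} (hV : HasHalfDegree a V) (hW : HasHalfDegree b W) :
    HasHalfDegree (a * b) (V + W) := by
  obtain ⟨F, ⟨hF, m, G, hG, ⟨ρ, hρ⟩, hGF⟩, ε, Q, k, w, μ, ⟨h1, h2, h3, h4, h5⟩, rfl⟩ := hV
  obtain ⟨F', ⟨hF', m', G', hG', ⟨ρ', hρ'⟩, hGF'⟩, ε', Q', k', w', μ',
    ⟨h1', h2', h3', h4', h5'⟩, rfl⟩ := hW
  refine ⟨fun s => F s * F' s, ⟨fun s hs => ?_, m + m', fun s => G s * G' s, hG.mul hG',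
    ⟨_, finiteOrder_mul hρ hρ'⟩, fun s hs => ?_⟩, ε * ε', Q * Q', k + k', Fin.append w w',
    Fin.append μ μ', ⟨?_, mul_pos h2 h2', ?_, ?_, ?_⟩, ?_⟩
  · beta_reduce
    rw [ArithmeticFunction.LSeries_mul' (ha.lseriesSummable hs) (hb.lseriesSummable hs), hF s hs,
      hF' s hs]
  · beta_reduce
    rw [hGF s hs, hGF' s hs]
    ring
  · rw [norm_mul, h1, h1', one_mul]
  · intro i
    refine Fin.addCases (fun i => ?_) (fun i => ?_) i
    · simpa using h3 i
    · simpa using h3' i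
  · intro i
    refine Fin.addCases (fun i => ?_) (fun i => ?_) i
    · simpa using h4 i
    · simpa using h4' i
  · have hreg : ∀ s, GammaRegularAt (Fin.append w w') (Fin.append μ μ') s →
        GammaRegularAt w μ s ∧ GammaRegularAt w' μ' s := by
      intro s hs
      constructor
      · intro i n
        simpa using hs (Fin.castAdd k' i) n
      · intro i n
        simpa using hs (Fin.natAdd k i) n
    have hγ : ∀ s, gammaFactor (ε * ε') (Q * Q') (Fin.append w w') (Fin.append μ μ') s =
        gammaFactor ε Q w μ s * gammaFactor ε' Q' w' μ' s := by
      intro s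
      simp only [gammaFactor]
      rw [Fin.prod_univ_add, Complex.ofReal_mul, mul_cpow_ofReal_nonneg h2.le h2'.le]
      simp only [Fin.append_left, Fin.append_right]
      ring
    intro s hs0 hs1 hr hr'
    have e1 := h5 s hs0 hs1 (hreg s hr).1 (hreg _ hr').1
    have e2 := h5' s hs0 hs1 (hreg s hr).2 (hreg _ hr').2
    rw [hγ, hγ]
    calc gammaFactor ε Q w μ s * gammaFactor ε' Q' w' μ' s * (F s * F' s)
        = (gammaFactor ε Q w μ s * F s) * (gammaFactor ε' Q' w' μ' s * F' s) := by ring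
      _ = _ := by
        rw [e1, e2, ← map_mul]
        congr 1
        ring
  · rw [Fin.sum_univ_add]
    simp

theorem pow_abs_le_one_add_sq_pow {n b : ℕ} (h : n ≤ 2 * b) (t : ℝ) :
    |t| ^ n ≤ (1 + t ^ 2) ^ b := by
  rcases le_total |t| 1 with h1 | h1
  · exact (pow_le_one₀ (abs_nonneg t) h1).trans (one_le_pow₀ (by nlinarith [sq_nonneg t]))
  · calc |t| ^ n ≤ |t| ^ (2 * b) := pow_le_pow_right₀ h1 h
      _ = (t ^ 2) ^ b := by rw [pow_mul, sq_abs]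
      _ ≤ _ := by gcongr; linarith

theorem exists_bound_of_isBigO_pow {f : ℝ → ℂ} (hf : Continuous f) {n b : ℕ}
    (h : f =O[cobounded ℝ] fun t : ℝ => t ^ n) (hnb : n ≤ 2 * b) :
    ∃ D : ℝ, ∀ t, ‖f t‖ ≤ D * (1 + t ^ 2) ^ b := by
  obtain ⟨C, hC⟩ := h.bound
  obtain ⟨R, -, hR⟩ := (hasBasis_cobounded_norm (E := ℝ)).eventually_iff.1 hC
  obtain ⟨M, hM⟩ := (isCompact_closedBall (0 : ℝ) R).exists_bound_of_continuousOn hf.continuousOn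
  refine ⟨|C| + |M|, fun t => ?_⟩
  have h1 : 1 ≤ (1 + t ^ 2) ^ b := one_le_pow₀ (by nlinarith [sq_nonneg t])
  rcases le_total R ‖t‖ with ht | ht
  · have h2 := hR ht
    rw [norm_pow, Real.norm_eq_abs] at h2
    calc ‖f t‖ ≤ C * |t| ^ n := h2
      _ ≤ (|C| + |M|) * |t| ^ n := by
          gcongr
          linarith [le_abs_self C, abs_nonneg M]
      _ ≤ _ := by
          gcongr
          exact pow_abs_le_one_add_sq_pow hnb t
  · calc ‖f t‖ ≤ M := hM t (by simpa using ht)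
      _ ≤ |C| + |M| := by linarith [le_abs_self M, abs_nonneg C]
      _ ≤ _ := le_mul_of_one_le_right (by positivity) h1

/-- `G` grows at most polynomially in the strip `a ≤ Re s ≤ b`. -/
def PolyBoundedStrip (G : ℂ → ℂ) (a b : ℝ) : Prop :=
  ∃ (C : ℝ) (e : ℕ), ∀ σ t : ℝ, a ≤ σ → σ ≤ b → ‖G (vert σ t)‖ ≤ C * (1 + t ^ 2) ^ e

/-- For passing from `(s - 1) ^ m F` to a pole-free variant of `F`: the comparison is only available
away from `s = 1`, and compactness covers the rest. -/
theorem PolyBoundedStrip.of_le_off_ball {G H : ℂ → ℂ} {a b K : ℝ} (hG : PolyBoundedStrip G a b)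
    (hH : Continuous H)
    (h : ∀ s : ℂ, a ≤ s.re → s.re ≤ b → 1 ≤ ‖s - 1‖ → ‖H s‖ ≤ K * ‖G s‖) :
    PolyBoundedStrip H a b := by
  obtain ⟨C, e, hC⟩ := hG
  obtain ⟨M, hM⟩ := (isCompact_closedBall (1 : ℂ) 1).exists_bound_of_continuousOn hH.continuousOn
  refine ⟨|K| * |C| + |M|, e, fun σ t h1 h2 => ?_⟩
  have h3 : 1 ≤ (1 + t ^ 2) ^ e := one_le_pow₀ (by nlinarith [sq_nonneg t])
  rcases le_total 1 ‖vert σ t - 1‖ with h4 | h4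
  · calc ‖H (vert σ t)‖ ≤ K * ‖G (vert σ t)‖ := h _ (by simpa) (by simpa) h4
      _ ≤ |K| * (C * (1 + t ^ 2) ^ e) :=
          mul_le_mul (le_abs_self K) (hC σ t h1 h2) (norm_nonneg _) (abs_nonneg _)
      _ ≤ |K| * (|C| * (1 + t ^ 2) ^ e) := by
          gcongr
          exact le_abs_self C
      _ ≤ _ := by
          rw [add_mul, mul_assoc]
          linarith [mul_nonneg (abs_nonneg M) (zero_le_one.trans h3)]
  · calc ‖H (vert σ t)‖ ≤ M := hM _ (by simpa [dist_eq_norm] using h4)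
      _ ≤ |K| * |C| + |M| := by
          linarith [le_abs_self M, mul_nonneg (abs_nonneg K) (abs_nonneg C)]
      _ ≤ _ := le_mul_of_one_le_right (by positivity) h3

theorem rpow_norm_le_exp_of_strip (ρ M : ℝ) {c : ℝ} (hc : 0 < c) :
    ∀ᶠ y : ℝ in atTop, ∀ s : ℂ, |s.re| ≤ M → |s.im| = y → ‖s‖ ^ ρ ≤ Real.exp (c * y) := by
  have h := (isLittleO_rpow_exp_pos_mul_atTop (max ρ 0) hc).def
    (show (0 : ℝ) < (2 ^ max ρ 0)⁻¹ by positivity)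
  filter_upwards [h, eventually_ge_atTop (max 1 M)] with y hy hyM s hsM hs
  have hy1 : 1 ≤ y := (le_max_left _ _).trans hyM
  have hyM : M ≤ y := (le_max_right _ _).trans hyM
  have h1 : 1 ≤ ‖s‖ := hy1.trans (hs ▸ abs_im_le_norm s)
  have h2 : ‖s‖ ≤ 2 * y := by
    have := norm_le_abs_re_add_abs_im s
    linarith
  rw [Real.norm_of_nonneg (by positivity), Real.norm_of_nonneg (by positivity),
    ← div_eq_inv_mul, le_div_iff₀ (by positivity)] at hy
  calc ‖s‖ ^ ρ ≤ ‖s‖ ^ max ρ 0 := Real.rpow_le_rpow_of_exponent_le h1 (le_max_left _ _)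
    _ ≤ (2 * y) ^ max ρ 0 := Real.rpow_le_rpow (norm_nonneg _) h2 (le_max_right _ _)
    _ = y ^ max ρ 0 * 2 ^ max ρ 0 := by
        rw [Real.mul_rpow (by norm_num) (by positivity), mul_comm]
    _ ≤ _ := hy

/-- Phragmén–Lindelöf applied to `G / (s - p) ^ (2 E)`, where `p` lies one unit to the right of the
strip, so that `|s - p|² ≥ 1 + t²` there. Finite order is far below the double exponential growth
that is allowed. -/
theorem polyBoundedStrip_of_finiteOrder {G : ℂ → ℂ} (hG : Differentiable ℂ G) {ρ : ℝ}
    (hρ : G =O[cobounded ℂ] fun s => Real.exp (‖s‖ ^ ρ)) {a b : ℝ} (hab : a < b) {D D' : ℝ}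
    {e e' : ℕ} (ha : ∀ t : ℝ, ‖G (vert a t)‖ ≤ D * (1 + t ^ 2) ^ e)
    (hb : ∀ t : ℝ, ‖G (vert b t)‖ ≤ D' * (1 + t ^ 2) ^ e') : PolyBoundedStrip G a b := by
  set E := max e e'
  set C := max D D'
  have hD0 : 0 ≤ D := by simpa using (norm_nonneg _).trans (ha 0)
  have hC0 : 0 ≤ C := hD0.trans (le_max_left _ _)
  have hone : ∀ t : ℝ, 1 ≤ 1 + t ^ 2 := fun t => by nlinarith [sq_nonneg t]
  have ha' : ∀ t : ℝ, ‖G (vert a t)‖ ≤ C * (1 + t ^ 2) ^ E := fun t => (ha t).trans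
    (mul_le_mul (le_max_left _ _) (pow_le_pow_right₀ (hone t) (le_max_left _ _))
      (by positivity) hC0)
  have hb' : ∀ t : ℝ, ‖G (vert b t)‖ ≤ C * (1 + t ^ 2) ^ E := fun t => (hb t).trans
    (mul_le_mul (le_max_right _ _) (pow_le_pow_right₀ (hone t) (le_max_right _ _))
      (by positivity) hC0)
  set p : ℂ := ((b + 1 : ℝ) : ℂ)
  have hsq : ∀ s : ℂ, ‖s - p‖ ^ 2 = (s.re - (b + 1)) ^ 2 + s.im ^ 2 := by
    intro s
    rw [← normSq_eq_norm_sq, normSq_apply]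
    simp [p]
    ring
  have hlow : ∀ s : ℂ, s.re ≤ b → 1 + s.im ^ 2 ≤ ‖s - p‖ ^ 2 := by
    intro s hs
    rw [hsq]
    nlinarith
  have hpow : ∀ s : ℂ, ‖(s - p) ^ (2 * E)‖ = (‖s - p‖ ^ 2) ^ E := fun s => by
    rw [norm_pow, pow_mul]
  set H : ℂ → ℂ := fun s => G s / (s - p) ^ (2 * E) with hH
  have hHle : ∀ s : ℂ, s.re ≤ b → ‖H s‖ ≤ ‖G s‖ / (1 + s.im ^ 2) ^ E := by
    intro s hs
    rw [hH, norm_div, hpow]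
    have := hlow s hs
    gcongr
  have hline : ∀ s : ℂ, s.re ≤ b → ‖G s‖ ≤ C * (1 + s.im ^ 2) ^ E → ‖H s‖ ≤ C := by
    intro s hs h
    refine (hHle s hs).trans ?_
    rw [div_le_iff₀ (by positivity)]
    exact h
  have hs_eq : ∀ s : ℂ, s = vert s.re s.im := fun s => by simp [vert]
  have hHd : DifferentiableOn ℂ H {s | s.re ≤ b} := by
    refine hG.differentiableOn.div (by fun_prop) fun s hs h0 => ?_
    have h1 := hlow s hs
    rw [pow_eq_zero_iff'] at h0
    rw [h0.1, norm_zero] at h1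
    nlinarith [sq_nonneg s.im]
  have hcl : DiffContOnCl ℂ H (re ⁻¹' Set.Ioo a b) := by
    refine ⟨hHd.mono fun s hs => hs.2.le, hHd.continuousOn.mono ?_⟩
    refine closure_minimal (fun s hs => hs.2.le) (isClosed_le continuous_re continuous_const)
  have hgrow : ∃ c < Real.pi / (b - a), ∃ B,
      H =O[comap (abs ∘ im) atTop ⊓ 𝓟 (re ⁻¹' Set.Ioo a b)]
        fun z => Real.exp (B * Real.exp (c * |z.im|)) := by
    have hpi : 0 < Real.pi / (b - a) := div_pos Real.pi_pos (sub_pos.2 hab)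
    refine ⟨Real.pi / (b - a) / 2, by linarith, 1, ?_⟩
    have htend : Tendsto (norm : ℂ → ℝ) (comap (abs ∘ im) atTop) atTop :=
      tendsto_atTop_mono (fun s => abs_im_le_norm s) tendsto_comap
    obtain ⟨K, hK⟩ := (hρ.mono (tendsto_norm_atTop_iff_cobounded.1 htend)).bound
    refine IsBigO.of_bound |K| ?_
    rw [eventually_inf_principal]
    have h2 := tendsto_comap.eventually
      (rpow_norm_le_exp_of_strip ρ (|a| + |b|) (half_pos hpi)) (f := (abs ∘ im : ℂ → ℝ))
    filter_upwards [hK, h2] with s hs1 hs2 hs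
    have hre : |s.re| ≤ |a| + |b| := by
      rw [abs_le]
      constructor
      · linarith [hs.1, neg_abs_le a, abs_nonneg b]
      · linarith [hs.2, le_abs_self b, abs_nonneg a]
    have h3 := hs2 s hre rfl
    rw [Real.norm_of_nonneg (Real.exp_pos _).le, one_mul]
    rw [Real.norm_of_nonneg (Real.exp_pos _).le] at hs1
    calc ‖H s‖ ≤ ‖G s‖ / (1 + s.im ^ 2) ^ E := hHle s hs.2.le
      _ ≤ ‖G s‖ := div_le_self (norm_nonneg _) (one_le_pow₀ (hone _))
      _ ≤ K * Real.exp (‖s‖ ^ ρ) := hs1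
      _ ≤ |K| * Real.exp (‖s‖ ^ ρ) := by gcongr; exact le_abs_self K
      _ ≤ _ := by gcongr; exact h3
  refine ⟨C * ((b - a + 2) ^ 2) ^ E, E, fun σ t h1 h2 => ?_⟩
  have h3 : ‖H (vert σ t)‖ ≤ C := by
    refine PhragmenLindelof.vertical_strip hcl hgrow ?_ ?_ (by simpa) (by simpa)
    · intro s hs
      refine hline s (by linarith) ?_
      have := ha' s.im
      rwa [← hs, ← hs_eq] at this
    · intro s hs
      refine hline s (by linarith) ?_
      have := hb' s.im
      rwa [← hs, ← hs_eq] at this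
  have h4 : 0 < ‖vert σ t - p‖ ^ 2 := by
    have := hlow (vert σ t) (by simpa)
    nlinarith [sq_nonneg (vert σ t).im]
  rw [hH, norm_div, hpow, div_le_iff₀ (by positivity)] at h3
  refine h3.trans ?_
  rw [mul_assoc, ← mul_pow]
  gcongr
  rw [hsq, vert_re, vert_im]
  nlinarith [sq_nonneg t, mul_nonneg (sub_nonneg.2 h1) (sub_nonneg.2 h2), sq_nonneg ((b-a+1)*t)]

end Selberg

/-! ### No half-degree strictly between `0` and `1/4` -/

namespace Selberg

open Complex Bornology Topology MeasureTheory

theorem coeff_isBigO {c : ℕ → ℂ} {F : ℂ → ℂ} (hF : Differentiable ℂ F)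
    (hs : LSeriesSummable c 2) (hFc : ∀ s : ℂ, 1 < s.re → F s = LSeries c s) {A : ℝ} (hA : 0 ≤ A)
    (hC : PolyBoundedStrip F (-A) 2) {b : ℕ} {D : ℝ}
    (hD : ∀ t : ℝ, ‖F (vert (-A) t)‖ ≤ D * (1 + t ^ 2) ^ b) :
    c =O[atTop] fun N : ℕ => (N : ℝ) ^ (-A + 4 * b) := by
  obtain ⟨C, e, hC⟩ := hC
  have hD0 : 0 ≤ D := by simpa using (norm_nonneg _).trans (hD 0)
  set K := ∑' n, ‖LSeries.term c 2 n‖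
  have hK : 0 ≤ K := tsum_nonneg fun n => norm_nonneg _
  have h1 := ((isLittleO_exp_neg_mul_rpow_atTop (show (0 : ℝ) < 1 / 32 by norm_num)
    (-A + 4 * b - 2)).comp_tendsto tendsto_natCast_atTop_atTop).isBigO.bound
  obtain ⟨M, hM⟩ := h1
  refine IsBigO.of_bound (Real.exp 8 * K * M +
    Real.exp (A ^ 2) * (D * (b.factorial * 2 ^ b * Real.exp (1 / 2)) * √2)) ?_
  filter_upwards [hM, eventually_ge_atTop 1] with N hMN hN
  have hN1 : (1 : ℝ) ≤ N := by exact_mod_cast hN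
  have hN0 : (0 : ℝ) < N := by linarith
  -- The choice `ε = N ^ (-4)` makes the off-diagonal factor `exp(-N² / 32)`, at the cost `ε ^ (-b)
  -- = N ^ (4 b)` in the main term.
  have hε1 : ((N : ℝ) ^ 4)⁻¹ ≤ 1 := inv_le_one_of_one_le₀ (one_le_pow₀ hN1)
  have hε : 0 < ((N : ℝ) ^ 4)⁻¹ := by positivity
  refine (norm_coeff_le hF hs hFc hA hC hN hε hε1 hD).trans ?_
  simp only [Function.comp] at hMN
  rw [Real.norm_of_nonneg (Real.exp_pos _).le, Real.norm_of_nonneg (by positivity)] at hMN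
  rw [Real.norm_of_nonneg (by positivity), add_mul]
  refine add_le_add ?_ ?_
  · have h2 : Real.exp (-1 / (32 * ((N : ℝ) ^ 4)⁻¹ * N ^ 2)) ≤
        M * (N : ℝ) ^ (-A + 4 * b - 2) := by
      refine le_trans (Real.exp_le_exp.2 ?_) hMN
      have : -1 / (32 * ((N : ℝ) ^ 4)⁻¹ * N ^ 2) = -(1 / 32) * N ^ 2 := by
        field_simp
      rw [this]
      nlinarith
    have h3 : Real.exp (8 * ((N : ℝ) ^ 4)⁻¹) ≤ Real.exp 8 := Real.exp_le_exp.2 (by linarith)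
    calc _ ≤ M * (N : ℝ) ^ (-A + 4 * b - 2) * Real.exp 8 * (N : ℝ) ^ (2 : ℝ) * K := by
          gcongr
          exact (Real.exp_pos _).le.trans h2
      _ = Real.exp 8 * K * M * ((N : ℝ) ^ (-A + 4 * b - 2) * (N : ℝ) ^ (2 : ℝ)) := by ring
      _ = _ := by
        rw [← Real.rpow_add hN0]
        congr 2
        ring
  · have h3 : Real.exp (((N : ℝ) ^ 4)⁻¹ * A ^ 2) ≤ Real.exp (A ^ 2) :=
      Real.exp_le_exp.2 (mul_le_of_le_one_left (sq_nonneg A) hε1)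
    have h4 : (N : ℝ) ^ (-A + 4 * b) = (N : ℝ) ^ (-A) * ((N : ℝ) ^ 4) ^ b := by
      rw [Real.rpow_add hN0, ← pow_mul, ← Real.rpow_natCast]
      push_cast
      rfl
    rw [h4, inv_pow, div_inv_eq_mul]
    calc _ ≤ (N : ℝ) ^ (-A) * Real.exp (A ^ 2) *
          (D * (b.factorial * 2 ^ b * Real.exp (1 / 2) * ((N : ℝ) ^ 4) ^ b) * √2) := by gcongr
      _ = _ := by ring

/-- A coefficient is bounded by the supremum of the continuation on a line to the left. -/
theorem norm_coeff_le_of_bounded {c : ℕ → ℂ} {F : ℂ → ℂ} (hF : Differentiable ℂ F)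
    (hs : LSeriesSummable c 2) (hFc : ∀ s : ℂ, 1 < s.re → F s = LSeries c s) {A : ℝ} (hA : 0 ≤ A)
    (hC : PolyBoundedStrip F (-A) 2) {D : ℝ} (hD : ∀ t : ℝ, ‖F (vert (-A) t)‖ ≤ D) {N : ℕ}
    (hN : 0 < N) : ‖c N‖ ≤ (N : ℝ) ^ (-A) * (D * Real.exp (1 / 2) * √2) := by
  obtain ⟨C, e, hC⟩ := hC
  have hN0 : (0 : ℝ) < N := by exact_mod_cast hN
  set K := ∑' n, ‖LSeries.term c 2 n‖
  have h1 : ∀ᶠ ε : ℝ in 𝓝[>] 0, ‖c N‖ ≤ Real.exp (-1 / (32 * ε * N ^ 2)) * Real.exp (8 * ε) *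
      (N : ℝ) ^ (2 : ℝ) * K + (N : ℝ) ^ (-A) * Real.exp (ε * A ^ 2) *
        (D * Real.exp (1 / 2) * √2) := by
    -- For a bounded function `b = 0`, so no negative power of `ε` appears and `ε → 0` is possible
    -- with `N` fixed.
    filter_upwards [Ioc_mem_nhdsGT (zero_lt_one' ℝ)] with ε hε
    have := norm_coeff_le hF hs hFc hA hC hN hε.1 hε.2 (b := 0) (D := D) (by simpa using hD)
    simpa using this
  have h2 : Tendsto (fun ε : ℝ => Real.exp (-1 / (32 * ε * N ^ 2))) (𝓝[>] 0) (𝓝 0) := by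
    have h3 : Tendsto (fun ε : ℝ => 1 / (32 * (N : ℝ) ^ 2) * ε⁻¹) (𝓝[>] 0) atTop :=
      tendsto_inv_nhdsGT_zero.const_mul_atTop (by positivity)
    refine (Real.tendsto_exp_neg_atTop_nhds_zero.comp h3).congr fun ε => ?_
    simp only [Function.comp]
    congr 1
    rw [neg_div, mul_right_comm, one_div_mul_eq_div, ← one_div, div_div, mul_comm (32 * _) ε,
      mul_comm ε]
  have h4 : Tendsto (fun ε : ℝ => Real.exp (8 * ε)) (𝓝[>] 0) (𝓝 1) := by
    have : Continuous fun ε : ℝ => Real.exp (8 * ε) := by fun_prop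
    simpa using (this.tendsto 0).mono_left nhdsWithin_le_nhds
  have h5 : Tendsto (fun ε : ℝ => Real.exp (ε * A ^ 2)) (𝓝[>] 0) (𝓝 1) := by
    have : Continuous fun ε : ℝ => Real.exp (ε * A ^ 2) := by fun_prop
    simpa using (this.tendsto 0).mono_left nhdsWithin_le_nhds
  have h6 := (((h2.mul h4).mul_const ((N : ℝ) ^ (2 : ℝ))).mul_const K).add
    ((h5.const_mul ((N : ℝ) ^ (-A))).mul_const (D * Real.exp (1 / 2) * √2))
  simpa using ge_of_tendsto h6 h1

theorem vert_ne_one {σ : ℝ} (hσ : σ ≠ 1) (t : ℝ) : vert σ t ≠ 1 := by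
  intro h
  have := congrArg re h
  simp at this
  exact hσ this

theorem isBigO_one_id_pow (n : ℕ) :
    (fun _ : ℝ => (1 : ℝ)) =O[cobounded ℝ] fun t : ℝ => t ^ n := by
  refine IsBigO.of_bound 1 ?_
  filter_upwards [tendsto_norm_cobounded_atTop.eventually_ge_atTop 1] with t ht
  rw [norm_one, one_mul, norm_pow]
  exact one_le_pow₀ ht

theorem vert_sub_one_isBigO (σ : ℝ) :
    (fun t => vert σ t - 1) =O[cobounded ℝ] fun t : ℝ => t := by
  have h1 : (fun _ : ℝ => ((σ : ℂ) - 1)) =O[cobounded ℝ] fun t : ℝ => t := by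
    refine (isBigO_const_const _ (one_ne_zero' ℝ) _).trans ?_
    simpa using isBigO_one_id_pow 1
  have h2 : (fun t : ℝ => (t : ℂ) * I) =O[cobounded ℝ] fun t : ℝ => t :=
    IsBigO.of_bound 1 (Eventually.of_forall fun t => by simp)
  refine (h1.add h2).congr_left fun t => ?_
  simp only [vert]
  ring

section Continuation

variable {a : ArithmeticFunction ℂ} {F G : ℂ → ℂ} {m : ℕ} {ρ : ℝ}

theorem SatisfiesFE.polyBoundedStrip {ε : ℂ} {Q : ℝ} {k : ℕ} {w : Fin k → ℝ} {μ : Fin k → ℂ}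
    (hFE : SatisfiesFE F ε Q w μ) (hF : HasAnalyticity a F) (hr : HasRamanujan a)
    (hG : Differentiable ℂ G) (hρ : G =O[cobounded ℂ] fun s => Real.exp (‖s‖ ^ ρ))
    (hGF : ∀ s : ℂ, s ≠ 1 → G s = (s - 1) ^ m * F s) {A : ℝ} (hA : 0 < A) :
    PolyBoundedStrip G (-A) 2 := by
  have key : ∀ (σ : ℝ) (n : ℕ), σ ≠ 1 →
      (fun t => F (vert σ t)) =O[cobounded ℝ] (fun t : ℝ => t ^ n) →
      ∃ D : ℝ, ∀ t, ‖G (vert σ t)‖ ≤ D * (1 + t ^ 2) ^ (m + n) := by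
    intro σ n hσ h
    refine exists_bound_of_isBigO_pow (n := m + n) (hG.continuous.comp (continuous_vert σ)) ?_
      (by omega)
    refine (((vert_sub_one_isBigO σ).pow m).mul h).congr (fun t => ?_) fun t => ?_
    · exact (hGF _ (vert_ne_one hσ t)).symm
    · rw [pow_add]
  obtain ⟨D, hD⟩ := key (-A) _ (by linarith)
    (hFE.isBigO_pow (hF.vert_isBigO_one hr (σ := 1 + A) (by linarith)))
  obtain ⟨D', hD'⟩ := key 2 0 (by norm_num)
    (by simpa using hF.vert_isBigO_one hr (σ := 2) (by norm_num))
  exact polyBoundedStrip_of_finiteOrder hG hρ (by linarith) hD hD'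

end Continuation

/-- The function `1 - 2 ^ (1 - s)`, which has a zero at `s = 1`. -/
noncomputable def twistFactor (s : ℂ) : ℂ := 1 - 2 ^ (1 - s)

theorem differentiable_twistFactor : Differentiable ℂ twistFactor := by
  intro s
  unfold twistFactor
  refine DifferentiableAt.sub (by fun_prop) ?_
  exact DifferentiableAt.const_cpow (by fun_prop) (Or.inl two_ne_zero)

theorem norm_two_cpow (s : ℂ) : ‖(2 : ℂ) ^ s‖ = 2 ^ s.re :=
  norm_cpow_eq_rpow_re_of_pos two_pos s

/-- Allows bounds for the twisted function on the left to be transferred back to `F`. -/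
theorem one_le_norm_twistFactor {s : ℂ} (hs : s.re ≤ 0) : 1 ≤ ‖twistFactor s‖ := by
  have h1 := norm_sub_norm_le ((2 : ℂ) ^ (1 - s)) 1
  rw [norm_sub_rev, norm_two_cpow, norm_one] at h1
  have h2 : (2 : ℝ) ^ (1 : ℝ) ≤ 2 ^ (1 - s).re :=
    Real.rpow_le_rpow_of_exponent_le (by norm_num) (by simp; linarith)
  rw [Real.rpow_one] at h2
  unfold twistFactor
  linarith

theorem norm_twistFactor_le {s : ℂ} {A : ℝ} (hs : -A ≤ s.re) :
    ‖twistFactor s‖ ≤ 1 + 2 ^ (1 + A) := by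
  refine (norm_sub_le _ _).trans ?_
  rw [norm_one, norm_two_cpow]
  gcongr
  · norm_num
  · simp; linarith

/-- The coefficients of the Dirichlet polynomial `1 - 2 ^ (1 - s)`. -/
noncomputable def twistCoeff : ArithmeticFunction ℂ :=
  ⟨fun n => if n = 1 then 1 else if n = 2 then -2 else 0, by simp⟩

theorem twistCoeff_term_support (s : ℂ) :
    ∀ n ∉ ({1, 2} : Finset ℕ), LSeries.term twistCoeff s n = 0 := by
  intro n hn
  simp only [Finset.mem_insert, Finset.mem_singleton, not_or] at hn
  simp [LSeries.term_def, twistCoeff, hn.1, hn.2]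

theorem lseriesSummable_twistCoeff (s : ℂ) : LSeriesSummable twistCoeff s :=
  summable_of_ne_finset_zero (twistCoeff_term_support s)

theorem LSeries_twistCoeff (s : ℂ) : LSeries twistCoeff s = twistFactor s := by
  rw [LSeries, tsum_eq_sum (twistCoeff_term_support s), Finset.sum_pair (by norm_num)]
  simp only [LSeries.term_def, twistCoeff, ArithmeticFunction.coe_mk, twistFactor]
  rw [cpow_sub _ _ two_ne_zero]
  simp
  ring

/-- Multiplying by `(s - 1) ^ m` would remove the pole but leave the world of Dirichlet series; the
twist, itself a Dirichlet polynomial, removes it and stays inside. -/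
theorem LSeries_mul_twistCoeff_pow {a : ArithmeticFunction ℂ} {s : ℂ} (ha : LSeriesSummable a s)
    (m : ℕ) : LSeriesSummable (a * twistCoeff ^ m : ArithmeticFunction ℂ) s ∧
      LSeries (a * twistCoeff ^ m : ArithmeticFunction ℂ) s = LSeries a s * twistFactor s ^ m := by
  induction m with
  | zero => simpa using ha
  | succ m ih =>
    rw [pow_succ, ← mul_assoc, pow_succ, ← mul_assoc, ← ih.2, ← LSeries_twistCoeff]
    exact ⟨ArithmeticFunction.LSeriesSummable_mul ih.1 (lseriesSummable_twistCoeff s),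
      ArithmeticFunction.LSeries_mul' ih.1 (lseriesSummable_twistCoeff s)⟩

theorem differentiable_dslope_twistFactor : Differentiable ℂ (dslope twistFactor 1) := by
  rw [← differentiableOn_univ, differentiableOn_dslope univ_mem]
  exact differentiable_twistFactor.differentiableOn

theorem dslope_twistFactor {s : ℂ} (hs : s ≠ 1) :
    dslope twistFactor 1 s = twistFactor s / (s - 1) := by
  have h := sub_smul_dslope twistFactor 1 s
  have h1 : twistFactor 1 = 0 := by simp [twistFactor]
  rw [h1, sub_zero, smul_eq_mul] at h
  rw [← h, mul_div_cancel_left₀ _ (sub_ne_zero.2 hs)]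

theorem LSeriesSummable_of_rapidDecay {c : ℕ → ℂ}
    (h : ∀ B : ℝ, c =O[atTop] fun N : ℕ => (N : ℝ) ^ (-B)) (s : ℂ) : LSeriesSummable c s := by
  refine LSeriesSummable_of_isBigO_rpow (x := s.re - 1) (by linarith) ?_
  have := h (-(s.re - 1 - 1))
  simpa using this

theorem differentiable_LSeries_of_summable {c : ℕ → ℂ} (h : ∀ s, LSeriesSummable c s) :
    Differentiable ℂ (LSeries c) := by
  intro s
  refine (LSeries_hasDerivAt ((h (s - 1)).abscissaOfAbsConv_le.trans_lt ?_)).differentiableAt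
  exact_mod_cast (by simp : (s - 1).re < s.re)

/-- A function of degree less than `1 / 2` has degree zero. -/
theorem SatisfiesFE.sum_nonpos {a : ArithmeticFunction ℂ} {F : ℂ → ℂ} {ε : ℂ} {Q : ℝ} {k : ℕ}
    {w : Fin k → ℝ} {μ : Fin k → ℂ} (hFE : SatisfiesFE F ε Q w μ) (hF : HasAnalyticity a F)
    (hr : HasRamanujan a) (he : HasEulerProduct a) (hw : ∑ i, w i < 1 / 4) : ∑ i, w i ≤ 0 := by
  obtain ⟨hFa, m, G, hG, ⟨ρ, hρ⟩, hGF⟩ := id hF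
  set W := ∑ i, w i with hW
  set c : ArithmeticFunction ℂ := a * twistCoeff ^ m
  set E : ℂ → ℂ := fun s => G s * dslope twistFactor 1 s ^ m with hE
  have hEd : Differentiable ℂ E := hG.mul (differentiable_dslope_twistFactor.pow m)
  have hEF : ∀ s, s ≠ 1 → E s = F s * twistFactor s ^ m := by
    intro s hs
    have : (s - 1) ^ m ≠ 0 := pow_ne_zero _ (sub_ne_zero.2 hs)
    rw [hE]
    beta_reduce
    rw [hGF s hs, dslope_twistFactor hs, div_pow]
    field_simp
  have hsum : ∀ s : ℂ, 1 < s.re → LSeriesSummable c s := fun s hs =>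
    (LSeries_mul_twistCoeff_pow (hr.lseriesSummable hs) m).1
  have hEc : ∀ s : ℂ, 1 < s.re → E s = LSeries c s := by
    intro s hs
    rw [hEF s (ne_one_of_one_lt_re hs), hFa s hs,
      (LSeries_mul_twistCoeff_pow (hr.lseriesSummable hs) m).2]
  have hstrip : ∀ A : ℝ, 0 < A → PolyBoundedStrip E (-A) 2 := by
    intro A hA
    refine (hFE.polyBoundedStrip hF hr hG hρ hGF hA).of_le_off_ball
      (K := (1 + 2 ^ (1 + A)) ^ m) hEd.continuous fun s h1 _ h3 => ?_
    have hs1 : s ≠ 1 := by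
      rintro rfl
      norm_num at h3
    rw [hE, norm_mul, mul_comm, norm_pow, dslope_twistFactor hs1, norm_div]
    gcongr
    exact (div_le_self (norm_nonneg _) h3).trans (norm_twistFactor_le h1)
  have hline : ∀ A : ℝ, 0 < A → (fun t => E (vert (-A) t)) =O[cobounded ℝ]
      fun t : ℝ => t ^ (∑ i, ⌈w i * (1 + 2 * A)⌉₊) := by
    intro A hA
    have h1 := hFE.isBigO_pow (hF.vert_isBigO_one hr (σ := 1 + A) (by linarith))
    have h2 : (fun t => twistFactor (vert (-A) t) ^ m) =O[cobounded ℝ] fun _ : ℝ => (1 : ℝ) := by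
      refine IsBigO.of_bound ((1 + 2 ^ (1 + A)) ^ m) (Eventually.of_forall fun t => ?_)
      rw [norm_pow, norm_one, mul_one]
      gcongr
      exact norm_twistFactor_le (by simp)
    refine (h1.mul h2).congr (fun t => ?_) fun t => by rw [mul_one]
    exact (hEF _ (vert_ne_one (by linarith) t)).symm
  have hdecay : ∀ B : ℝ, c =O[atTop] fun N : ℕ => (N : ℝ) ^ (-B) := by
    intro B
    -- With `b = (n + 1) / 2` and `n ≤ W (1 + 2A) + k`, the exponent `-A + 4 b` is at most `-A (1 -
    -- 4 W) + 2 W + 2 k + 2`. It tends to `-∞` with `A` exactly when `W < 1/4`, and this `A` brings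
    -- it below `-B`.
    set A : ℝ := (|B| + 2 * |W| + 2 * k + 3) / (1 - 4 * W) with hAdef
    have hden : 0 < 1 - 4 * W := by linarith
    have hA : 0 < A := by positivity
    set n := ∑ i, ⌈w i * (1 + 2 * A)⌉₊
    have hn : (n : ℝ) ≤ W * (1 + 2 * A) + k := sum_ceil_le hFE.2.2.1 (by linarith)
    obtain ⟨D, hD⟩ := exists_bound_of_isBigO_pow (b := (n + 1) / 2)
      (hEd.continuous.comp (continuous_vert (-A))) (hline A hA) (by omega)
    refine (coeff_isBigO hEd (hsum 2 (by norm_num)) hEc hA.le (hstrip A hA) hD).trans ?_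
    refine IsBigO.of_bound 1 ?_
    filter_upwards [eventually_ge_atTop 1] with N hN
    have hN1 : (1 : ℝ) ≤ N := by exact_mod_cast hN
    rw [Real.norm_of_nonneg (by positivity), Real.norm_of_nonneg (by positivity), one_mul]
    refine Real.rpow_le_rpow_of_exponent_le hN1 ?_
    have h1 : 2 * (((n + 1) / 2 : ℕ) : ℝ) ≤ n + 1 := by
      have : 2 * ((n + 1) / 2) ≤ n + 1 := by omega
      exact_mod_cast this
    have h2 : A * (1 - 4 * W) = |B| + 2 * |W| + 2 * k + 3 := div_mul_cancel₀ _ hden.ne'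
    nlinarith [le_abs_self B, le_abs_self W]
  have hall := LSeriesSummable_of_rapidDecay hdecay
  -- Absolute convergence everywhere makes `E` bounded on every vertical line, whereas the
  -- functional equation forces growth for `W > 0`.
  have hEL : E = LSeries c :=
    eq_of_eq_on_re_gt_one hEd (differentiable_LSeries_of_summable hall) hEc
  by_contra! hpos
  -- Large enough that the growth exponent, at least `W (1 + 2A) - k`, is positive.
  set A : ℝ := (k + 1) / W with hAdef
  have hA : 0 < A := by positivity
  have hEb : (fun t => E (vert (-A) t)) =O[cobounded ℝ] fun _ : ℝ => (1 : ℝ) := by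
    rw [hEL]
    exact LSeries_vert_isBigO_one (hall _) _
  have hFb : (fun t => F (vert (-A) t)) =O[cobounded ℝ] fun t : ℝ => t ^ 0 := by
    simp_rw [pow_zero]
    refine IsBigO.trans (IsBigO.of_bound 1 (Eventually.of_forall fun t => ?_)) hEb
    rw [hEF _ (vert_ne_one (by linarith) t), norm_mul, norm_pow, one_mul]
    exact le_mul_of_one_le_right (norm_nonneg _)
      (one_le_pow₀ (one_le_norm_twistFactor (by simp; linarith)))
  have h1 := le_of_pow_isBigO_pow
    ((hFE.pow_isBigO hA (hF.one_isBigO_vert he (by linarith))).trans hFb)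
  have h2 := sum_floor_ge w (1 + 2 * A)
  rw [Nat.le_zero.1 h1, ← hW] at h2
  have h3 : W * A = k + 1 := mul_div_cancel₀ _ hpos.ne'
  push_cast at h2
  nlinarith [Nat.cast_nonneg (α := ℝ) k]

end Selberg

/-! ### Consequences of the Euler product -/

namespace Selberg

open Complex Bornology Topology

theorem abscissaOfAbsConv_lt_of_summable {c : ℕ → ℂ}
    (h : ∀ s : ℂ, 1 < s.re → LSeriesSummable c s) {s : ℂ} (hs : 1 < s.re) :
    LSeries.abscissaOfAbsConv c < s.re := by
  have h1 := (h (((1 + s.re) / 2 : ℝ) : ℂ) (by rw [ofReal_re]; linarith)).abscissaOfAbsConv_le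
  refine h1.trans_lt ?_
  rw [ofReal_re]
  exact_mod_cast (by linarith : (1 + s.re) / 2 < s.re)

/-- The coefficient identity behind `F' = (log F)' F`. -/
theorem log_mul_eq_sum_of_exp_LSeries {a : ArithmeticFunction ℂ} {b : ℕ → ℂ}
    (ha : ∀ s : ℂ, 1 < s.re → LSeriesSummable a s)
    (hb : ∀ s : ℂ, 1 < s.re → LSeriesSummable b s ∧ Complex.exp (LSeries b s) = LSeries a s)
    {n : ℕ} (hn : n ≠ 0) :
    Complex.log n * a n = ∑ d ∈ n.divisors, Complex.log d * b d * a (n / d) := by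
  set β : ArithmeticFunction ℂ := ⟨LSeries.logMul b, by simp⟩
  have hA : ∀ {s : ℂ}, 1 < s.re → LSeries.abscissaOfAbsConv a < s.re := fun hs =>
    abscissaOfAbsConv_lt_of_summable ha hs
  have hB : ∀ {s : ℂ}, 1 < s.re → LSeries.abscissaOfAbsConv b < s.re := fun hs =>
    abscissaOfAbsConv_lt_of_summable (fun s hs => (hb s hs).1) hs
  have hβs : ∀ s : ℂ, 1 < s.re → LSeriesSummable β s := fun s hs =>
    LSeriesSummable_logMul_of_lt_re (hB hs)
  have hmul : ∀ s : ℂ, 1 < s.re → LSeriesSummable (β * a : ArithmeticFunction ℂ) s := fun s hs =>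
    ArithmeticFunction.LSeriesSummable_mul (hβs s hs) (ha s hs)
  have key : ∀ s : ℂ, 1 < s.re →
      LSeries (LSeries.logMul a) s = LSeries (β * a : ArithmeticFunction ℂ) s := by
    intro s hs
    have h1 : HasDerivAt (fun z => Complex.exp (LSeries b z))
        (Complex.exp (LSeries b s) * -LSeries (LSeries.logMul b) s) s :=
      (LSeries_hasDerivAt (hB hs)).cexp
    have h2 : (fun z => Complex.exp (LSeries b z)) =ᶠ[𝓝 s] LSeries a :=
      eventually_of_mem ((isOpen_lt continuous_const continuous_re).mem_nhds hs)
        fun z hz => (hb z hz).2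
    have h3 := (h1.congr_of_eventuallyEq h2.symm).unique (LSeries_hasDerivAt (hA hs))
    rw [(hb s hs).2] at h3
    rw [ArithmeticFunction.LSeries_mul' (hβs s hs) (ha s hs)]
    change _ = LSeries (LSeries.logMul b) s * LSeries a s
    linear_combination h3
  have htop : ∀ c : ℕ → ℂ, (∀ s : ℂ, 1 < s.re → LSeriesSummable c s) →
      LSeries.abscissaOfAbsConv c < ⊤ := fun c hc =>
    (abscissaOfAbsConv_lt_of_summable hc (s := 2) (by norm_num)).trans_le le_top
  have h := LSeries.eq_of_LSeries_eventually_eq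
    (htop _ fun s hs => LSeriesSummable_logMul_of_lt_re (hA hs)) (htop _ hmul)
    (eventually_of_mem (Ioi_mem_atTop 1) fun x hx => key x (by simpa using hx)) hn
  simp only [LSeries.logMul] at h
  rw [h, ArithmeticFunction.mul_apply, Nat.sum_divisorsAntidiagonal fun i j => β i * a j]
  rfl

/-- A prime power dividing `m n`, with `m` and `n` coprime, divides exactly one of them, so the
recursion for `m n` splits into those for `m` and `n`. By induction it reads `log (m n) a(m n) =
(log m + log n) a(m) a(n)`. -/
theorem isMultiplicative_of_log_mul_eq {a : ArithmeticFunction ℂ} {b : ℕ → ℂ} (ha : a 1 = 1)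
    (hb : ∀ n, ¬ IsPrimePow n → b n = 0)
    (h : ∀ n : ℕ, n ≠ 0 →
      Complex.log n * a n = ∑ d ∈ n.divisors, Complex.log d * b d * a (n / d)) :
    a.IsMultiplicative := by
  have hfilter : ∀ (s : Finset ℕ) (f : ℕ → ℂ),
      ∑ d ∈ s, Complex.log d * b d * f d =
        ∑ d ∈ s with IsPrimePow d, Complex.log d * b d * f d := by
    intro s f
    refine (Finset.sum_filter_of_ne fun d _ hd => ?_).symm
    by_contra hp
    exact hd (by rw [hb d hp]; ring)
  refine ⟨ha, ?_⟩
  suffices key : ∀ N m n : ℕ, m * n = N → m.Coprime n → a (m * n) = a m * a n from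
    fun {m n} hmn => key _ m n rfl hmn
  intro N
  induction N using Nat.strong_induction_on with
  | _ N ih =>
  intro m n hN hmn
  rcases Nat.eq_zero_or_pos m with rfl | hm
  · simp
  rcases Nat.eq_zero_or_pos n with rfl | hn
  · simp
  by_cases h1 : m * n = 1
  · obtain ⟨rfl, rfl⟩ := mul_eq_one.1 h1
    simp [ha]
  have hmn0 : m * n ≠ 0 := by positivity
  have hlog : Complex.log ((m * n : ℕ) : ℂ) = Complex.log m + Complex.log n := by
    rw [← natCast_log, ← natCast_log, ← natCast_log, Nat.cast_mul,
      Real.log_mul (by positivity) (by positivity)]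
    push_cast
    rfl
  have hlog0 : Complex.log ((m * n : ℕ) : ℂ) ≠ 0 := by
    rw [← natCast_log]
    have : (1 : ℝ) < ((m * n : ℕ) : ℝ) := by
      have : 1 < m * n := by omega
      exact_mod_cast this
    exact_mod_cast (Real.log_pos this).ne'
  have hdisj : Disjoint (m.divisors.filter IsPrimePow) (n.divisors.filter IsPrimePow) := by
    rw [Finset.disjoint_left]
    intro d hd hd'
    simp only [Finset.mem_filter, Nat.mem_divisors] at hd hd'
    exact hd.2.ne_one (Nat.eq_one_of_dvd_coprimes hmn hd.1.1 hd'.1.1)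
  have hpart : ∀ u v : ℕ, 0 < u → 0 < v → u * v = N → u.Coprime v →
      ∑ d ∈ u.divisors with IsPrimePow d, Complex.log d * b d * a (u * v / d) =
        Complex.log u * a u * a v := by
    intro u v hu hv huv hcop
    rw [h u hu.ne', hfilter u.divisors, Finset.sum_mul]
    refine Finset.sum_congr rfl fun d hd => ?_
    simp only [Finset.mem_filter, Nat.mem_divisors] at hd
    obtain ⟨⟨⟨q, rfl⟩, -⟩, hpp⟩ := hd
    have hd0 : 0 < d := hpp.pos
    have hq : 0 < q := Nat.pos_of_mul_pos_left hu
    rw [mul_assoc d q v, Nat.mul_div_cancel_left _ hd0, Nat.mul_div_cancel_left _ hd0]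
    rw [ih (q * v) ?_ q v rfl (Nat.Coprime.coprime_mul_left hcop), mul_assoc (_ * _) (a q)]
    rw [← huv, mul_assoc]
    exact lt_mul_of_one_lt_left (by positivity) hpp.one_lt
  have h2 := h (m * n) hmn0
  rw [hfilter, Nat.mul_divisors_filter_prime_pow hmn, Finset.filter_union,
    Finset.sum_union hdisj, hpart m n hm hn hN hmn] at h2
  have h3 := hpart n m hn hm (by rw [mul_comm, hN]) hmn.symm
  rw [mul_comm n m] at h3
  rw [h3, hlog] at h2
  rw [hlog] at hlog0
  refine mul_left_cancel₀ hlog0 ?_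
  rw [h2]
  ring

/-! ### Zeros and leading coefficients of local factors -/

section LocalFactor

open Polynomial

theorem hasSum_coeff_mul_pow (P : ℂ[X]) (x : ℂ) : HasSum (fun j => P.coeff j * x ^ j) (P.eval x) := by
  rw [eval_eq_sum_range]
  refine hasSum_sum_of_ne_finset_zero fun j hj => ?_
  rw [coeff_eq_zero_of_natDegree_lt (by simpa using hj), zero_mul]

theorem summable_norm_coeff_mul_pow (P : ℂ[X]) (x : ℂ) :
    Summable fun j => ‖P.coeff j * x ^ j‖ := by
  refine summable_of_ne_finset_zero (s := Finset.range (P.natDegree + 1)) fun j hj => ?_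
  rw [coeff_eq_zero_of_natDegree_lt (by simpa using hj), zero_mul, norm_zero]

/-- If the coefficients of `log P` grow at most like `R ^ i`, then `P` has no zeros in
`|x| < 1 / R`. -/
theorem one_le_mul_norm_of_root {P : ℂ[X]} (h0 : P.coeff 0 = 1) {β : ℕ → ℂ}
    (hβ : ∀ j : ℕ, (j : ℂ) * P.coeff j =
      ∑ kl ∈ Finset.HasAntidiagonal.antidiagonal j, (kl.1 * β kl.1) * P.coeff kl.2)
    {C R : ℝ} (hR : 0 < R) (hC : ∀ i, 0 < i → ‖β i‖ ≤ C * R ^ i) {x₀ : ℂ} (hx₀ : P.eval x₀ = 0) :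
    1 ≤ R * ‖x₀‖ := by
  by_contra! hlt
  have hP0 : P.eval 0 = 1 := by rw [← coeff_zero_eq_eval_zero, h0]
  have hx₀0 : x₀ ≠ 0 := by
    rintro rfl
    rw [hP0] at hx₀
    exact one_ne_zero hx₀
  set r := ‖x₀‖ with hr
  have hr0 : 0 < r := norm_pos_iff.2 hx₀0
  have hterm : ∀ x : ℂ, ‖x‖ ≤ r → ∀ i, ‖(i * β i) * x ^ i‖ ≤
      ‖x‖ * (C / r * ((i : ℝ) ^ 1 * (R * r) ^ i)) := by
    intro x hx i
    rcases Nat.eq_zero_or_pos i with rfl | hi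
    · simp
    obtain ⟨l, rfl⟩ : ∃ l, i = l + 1 := ⟨i - 1, by omega⟩
    have h1 := hC _ hi
    have h2 : 0 ≤ C * R ^ (l + 1) := (norm_nonneg _).trans h1
    rw [norm_mul, norm_mul, norm_pow, Complex.norm_natCast]
    calc ((l + 1 : ℕ) : ℝ) * ‖β (l + 1)‖ * ‖x‖ ^ (l + 1)
        ≤ ((l + 1 : ℕ) : ℝ) * (C * R ^ (l + 1)) * (r ^ l * ‖x‖) := by
          rw [pow_succ]; gcongr
      _ = _ := by field_simp; ring
  have hgeom : Summable fun i : ℕ => (i : ℝ) ^ 1 * (R * r) ^ i := by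
    refine summable_pow_mul_geometric_of_norm_lt_one 1 ?_
    rwa [Real.norm_of_nonneg (by positivity)]
  set K := ∑' i : ℕ, C / r * ((i : ℝ) ^ 1 * (R * r) ^ i) with hK
  -- The recursion is the identity `x P'(x) = (∑ i βᵢ xⁱ) P(x)`. The series converges for `|x| ≤ r`
  -- since `R r < 1`, and it is `O(|x|)`, so a factor `|x|` cancels.
  have hderiv : ∀ x : ℂ, x ≠ 0 → ‖x‖ ≤ r → ‖(derivative P).eval x‖ ≤ K * ‖P.eval x‖ := by
    intro x hx hxr
    have hs : Summable fun i : ℕ => ‖(i * β i) * x ^ i‖ :=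
      Summable.of_nonneg_of_le (fun _ => norm_nonneg _) (hterm x hxr)
        ((hgeom.mul_left _).mul_left _)
    have h1 := tsum_mul_tsum_eq_tsum_sum_antidiagonal_of_summable_norm hs
      (summable_norm_coeff_mul_pow P x)
    have h2 : ∀ j : ℕ, ∑ kl ∈ Finset.HasAntidiagonal.antidiagonal j,
        (kl.1 * β kl.1) * x ^ kl.1 * (P.coeff kl.2 * x ^ kl.2) =
          (X * derivative P).coeff j * x ^ j := by
      intro j
      have h3 : (X * derivative P).coeff j = j * P.coeff j := by
        rcases j with _ | j
        · simp
        · rw [coeff_X_mul, coeff_derivative]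
          push_cast
          ring
      rw [h3, hβ, Finset.sum_mul]
      refine Finset.sum_congr rfl fun kl hkl => ?_
      rw [← Finset.HasAntidiagonal.mem_antidiagonal.1 hkl, pow_add]
      ring
    simp_rw [h2] at h1
    rw [(hasSum_coeff_mul_pow P x).tsum_eq, (hasSum_coeff_mul_pow _ x).tsum_eq, eval_mul,
      eval_X] at h1
    have h4 : ‖∑' i : ℕ, (i * β i) * x ^ i‖ ≤ ‖x‖ * K :=
      tsum_of_norm_bounded ((hgeom.mul_left _).hasSum.mul_left _) (hterm x hxr)
    have h5 := congrArg norm h1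
    rw [norm_mul, norm_mul] at h5
    refine le_of_mul_le_mul_left (a := ‖x‖) ?_ (norm_pos_iff.2 hx)
    rw [← h5, ← mul_assoc]
    gcongr
  have hK0 : 0 ≤ K := by
    refine tsum_nonneg fun i => ?_
    have : 0 ≤ C := by
      have h1 := (norm_nonneg _).trans (hC 1 one_pos)
      rw [pow_one] at h1
      exact nonneg_of_mul_nonneg_left h1 hR
    positivity
  have hz : ∀ t : ℝ, HasDerivAt (fun t : ℝ => P.eval ((1 - t : ℂ) * x₀))
      ((derivative P).eval ((1 - t : ℂ) * x₀) * -x₀) t := by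
    intro t
    have h1 : HasDerivAt (fun t : ℝ => (1 - t : ℂ) * x₀) (-x₀) t := by
      simpa using ((Complex.ofRealCLM.hasDerivAt (x := t)).const_sub 1).mul_const x₀
    exact (P.hasDerivAt _).comp t h1
  -- Grönwall along the segment from `x₀` to `0`: a zero at `x₀` would propagate to `P(0) = 1`.
  have hzero := eq_zero_of_abs_deriv_le_mul_abs_self_of_eq_zero_right (a := 0) (b := 1)
    (K := K * r) (f := fun t : ℝ => P.eval ((1 - t : ℂ) * x₀))
    (fun t _ => (hz t).continuousAt.continuousWithinAt) (fun t _ => (hz t).hasDerivWithinAt)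
    (by simpa using hx₀) ?_ 1 (by simp)
  · simp [hP0] at hzero
  · intro t ht
    have h1 : (1 - t : ℂ) ≠ 0 := by
      have : (1 - t : ℝ) ≠ 0 := by linarith [ht.2]
      exact_mod_cast this
    have h2 : ‖(1 - t : ℂ) * x₀‖ ≤ r := by
      rw [norm_mul]
      refine mul_le_of_le_one_left hr0.le ?_
      have : (1 - t : ℂ) = ((1 - t : ℝ) : ℂ) := by push_cast; ring
      rw [this, Complex.norm_real, Real.norm_of_nonneg (by linarith [ht.2])]
      linarith [ht.1]
    rw [norm_mul, norm_neg, mul_right_comm]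
    gcongr
    exact hderiv _ (mul_ne_zero h1 hx₀0) h2

/-- The constant term `1` is, up to sign, the leading coefficient times the product of the roots,
and each root has absolute value at least `1 / R`. -/
theorem norm_leadingCoeff_le {P : ℂ[X]} (h0 : P.coeff 0 = 1) {β : ℕ → ℂ}
    (hβ : ∀ j : ℕ, (j : ℂ) * P.coeff j =
      ∑ kl ∈ Finset.HasAntidiagonal.antidiagonal j, (kl.1 * β kl.1) * P.coeff kl.2)
    {C R : ℝ} (hR : 0 < R) (hC : ∀ i, 0 < i → ‖β i‖ ≤ C * R ^ i) :
    ‖P.leadingCoeff‖ ≤ R ^ P.natDegree := by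
  have hs := IsAlgClosed.splits P
  have h1 := congrArg norm hs.coeff_zero_eq_leadingCoeff_mul_prod_roots
  have hP : P ≠ 0 := by
    rintro rfl
    simp at h0
  have h2 : ∀ S : Multiset ℂ, (∀ x ∈ S, 1 ≤ R * ‖x‖) → 1 ≤ R ^ S.card * ‖S.prod‖ := by
    intro S
    induction S using Multiset.induction_on with
    | empty => simp
    | cons x S ih =>
      intro h
      rw [Multiset.card_cons, Multiset.prod_cons, norm_mul, pow_succ]
      have e1 := h x (Multiset.mem_cons_self x S)
      have e2 := ih fun y hy => h y (Multiset.mem_cons_of_mem hy)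
      calc (1 : ℝ) ≤ (R * ‖x‖) * (R ^ S.card * ‖S.prod‖) := by
            nlinarith
        _ = _ := by ring
  have h3 := h2 P.roots fun x hx =>
    one_le_mul_norm_of_root h0 hβ hR hC ((mem_roots hP).1 hx)
  rw [← hs.natDegree_eq_card_roots] at h3
  rw [h0, norm_mul, norm_mul, norm_pow, norm_neg, norm_one, one_pow, one_mul] at h1
  calc ‖P.leadingCoeff‖ ≤ ‖P.leadingCoeff‖ * (R ^ P.natDegree * ‖P.roots.prod‖) :=
        le_mul_of_one_le_right (norm_nonneg _) h3
    _ = R ^ P.natDegree * (‖P.leadingCoeff‖ * ‖P.roots.prod‖) := by ring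
    _ = _ := by rw [← h1, mul_one]

end LocalFactor

/-- If only finitely many powers of `p` carry a coefficient, the last nonzero one is small. -/
theorem norm_last_primePow_coeff_le {a : ArithmeticFunction ℂ} {b : ℕ → ℂ} (ha : a 1 = 1)
    (h : ∀ n : ℕ, n ≠ 0 →
      Complex.log n * a n = ∑ d ∈ n.divisors, Complex.log d * b d * a (n / d))
    {C θ : ℝ} (hC : ∀ n : ℕ, n ≠ 0 → ‖b n‖ ≤ C * (n : ℝ) ^ θ) {p e : ℕ} (hp : p.Prime)
    (he : a (p ^ e) ≠ 0) (hlast : ∀ j, e < j → a (p ^ j) = 0) :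
    ‖a (p ^ e)‖ ≤ ((p : ℝ) ^ θ) ^ e := by
  have hp0 : (0 : ℝ) < p := by exact_mod_cast hp.pos
  set P : Polynomial ℂ := ∑ j ∈ Finset.range (e + 1), Polynomial.monomial j (a (p ^ j)) with hP
  have hcoeff : ∀ j, P.coeff j = a (p ^ j) := by
    intro j
    simp only [hP, Polynomial.finsetSum_coeff, Polynomial.coeff_monomial]
    rw [Finset.sum_ite_eq' (Finset.range (e + 1)) j]
    split_ifs with hj
    · rfl
    · exact (hlast j (by simpa using hj)).symm
  have hdeg : P.natDegree = e := by
    refine Polynomial.natDegree_eq_of_le_of_coeff_ne_zero ?_ (by rwa [hcoeff])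
    exact Polynomial.natDegree_le_iff_coeff_eq_zero.2 fun j hj => by rw [hcoeff, hlast j hj]
  have hlogp : Complex.log p ≠ 0 := by
    rw [← natCast_log]
    exact_mod_cast (Real.log_pos (by exact_mod_cast hp.one_lt)).ne'
  have hlog : ∀ j : ℕ, Complex.log ((p ^ j : ℕ) : ℂ) = j * Complex.log p := by
    intro j
    rw [← natCast_log, ← natCast_log, Nat.cast_pow, Real.log_pow]
    push_cast
    rfl
  -- `P` is the local factor at `p` in the variable `p ^ (-s)`. The recursion at `n = p ^ j`,
  -- divided by `log p`, is the one required of `P`.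
  have hmain := norm_leadingCoeff_le (P := P) (β := fun i => b (p ^ i)) (C := C)
    (R := (p : ℝ) ^ θ) (by rw [hcoeff, pow_zero, ha]) ?_ (by positivity) ?_
  · rwa [Polynomial.leadingCoeff, hdeg, hcoeff] at hmain
  · intro j
    have h1 := h (p ^ j) (pow_ne_zero _ hp.ne_zero)
    rw [Nat.sum_divisors_prime_pow hp, hlog] at h1
    rw [Finset.Nat.sum_antidiagonal_eq_sum_range_succ
      fun k l => (k * b (p ^ k)) * P.coeff l]
    refine mul_left_cancel₀ hlogp ?_
    rw [hcoeff, Finset.mul_sum, ← mul_assoc, mul_comm (Complex.log p), h1]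
    refine Finset.sum_congr rfl fun i hi => ?_
    rw [hlog, hcoeff, Nat.pow_div (by simpa [Nat.lt_succ_iff] using hi) hp.pos]
    ring
  · intro i _
    refine (hC _ (pow_ne_zero _ hp.ne_zero)).trans (le_of_eq ?_)
    rw [Nat.cast_pow, ← Real.rpow_natCast, ← Real.rpow_mul hp0.le, ← Real.rpow_natCast,
      ← Real.rpow_mul hp0.le, mul_comm θ]

/-- The last nonzero coefficient of a nontrivial Dirichlet polynomial with an Euler product is
smaller than `√M`. -/
theorem norm_last_coeff_lt {a : ArithmeticFunction ℂ} (hr : HasRamanujan a)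
    (he : HasEulerProduct a) {M : ℕ} (hM : 1 < M) (haM : a M ≠ 0)
    (hlast : ∀ n, M < n → a n = 0) : ‖a M‖ < √M := by
  obtain ⟨h1, b, θ, hθ, hb0, hbO, hb⟩ := he
  have hrec := fun n hn => log_mul_eq_sum_of_exp_LSeries (a := a) (b := b)
    (fun s hs => hr.lseriesSummable hs) hb (n := n) hn
  have hmult := isMultiplicative_of_log_mul_eq h1 hb0 hrec
  obtain ⟨C, -, hC⟩ := bound_of_isBigO_nat_atTop hbO
  have hC' : ∀ n : ℕ, n ≠ 0 → ‖b n‖ ≤ C * (n : ℝ) ^ θ := by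
    intro n hn
    have hn0 : (0 : ℝ) < n := by exact_mod_cast Nat.pos_of_ne_zero hn
    have := hC (x := n) (Real.rpow_pos_of_pos hn0 θ).ne'
    rwa [Real.norm_of_nonneg (Real.rpow_nonneg hn0.le _)] at this
  have hM0 : M ≠ 0 := by omega
  have hfac := hmult.multiplicative_factorization a hM0
  have hMfac : (M : ℝ) = M.factorization.prod fun p k => (p : ℝ) ^ k := by
    conv_lhs => rw [← Nat.prod_factorization_pow_eq_self hM0]
    rw [Nat.cast_finsuppProd]
    push_cast
    rfl
  rw [hfac, hMfac, Finsupp.prod, Finsupp.prod, norm_prod, Real.sqrt_eq_rpow,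
    ← Real.finsetProd_rpow _ _ fun p _ => by positivity]
  rw [hfac, Finsupp.prod, Finset.prod_ne_zero_iff] at haM
  refine Finset.prod_lt_prod_of_nonempty (fun p hp => norm_pos_iff.2 (haM p hp)) ?_ ?_
  · intro p hp
    rw [Nat.support_factorization] at hp
    have hpp := Nat.prime_of_mem_primeFactors hp
    have hp1 : (1 : ℝ) < p := by exact_mod_cast hpp.one_lt
    have hp0 : (0 : ℝ) < p := by linarith
    set e := M.factorization p with hedef
    have he0 : 0 < e := hpp.factorization_pos_of_dvd hM0 (Nat.dvd_of_mem_primeFactors hp)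
    -- Write `M = p ^ e q`. A nonzero `a (p ^ j)` with `j > e` would, by multiplicativity, give a
    -- nonzero coefficient at `p ^ j q > M`.
    have hlastp : ∀ j, e < j → a (p ^ j) = 0 := by
      intro j hj
      obtain ⟨q, hq⟩ : p ^ e ∣ M := Nat.ordProj_dvd M p
      have hcop : ∀ i, (p ^ i).Coprime q := by
        intro i
        refine Nat.Coprime.pow_left i ((Nat.Prime.coprime_iff_not_dvd hpp).2 fun hpq => ?_)
        refine Nat.pow_succ_factorization_not_dvd hM0 hpp ?_
        rw [← hedef, pow_succ]
        conv_rhs => rw [hq]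
        exact Nat.mul_dvd_mul_left _ hpq
      have hMp : a (p ^ e) * a q ≠ 0 := by
        rw [← hmult.2 (hcop e), ← hq, hfac, Finsupp.prod]
        exact Finset.prod_ne_zero_iff.2 haM
      have hq0 : 0 < q := Nat.pos_of_ne_zero (by rintro rfl; simp at hq; omega)
      have h2 : a (p ^ j * q) = 0 := by
        refine hlast _ ?_
        conv_lhs => rw [hq]
        exact Nat.mul_lt_mul_of_pos_right (Nat.pow_lt_pow_right hpp.one_lt hj) hq0
      rw [hmult.2 (hcop j)] at h2
      exact (mul_eq_zero.1 h2).resolve_right (right_ne_zero_of_mul hMp)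
    refine (norm_last_primePow_coeff_le h1 hrec hC' hpp (haM p (by simpa using hp))
      hlastp).trans_lt ?_
    rw [← Real.rpow_natCast, ← Real.rpow_mul hp0.le, ← Real.rpow_natCast (p : ℝ),
      ← Real.rpow_mul hp0.le]
    refine Real.rpow_lt_rpow_of_exponent_lt hp1 ?_
    have : (0 : ℝ) < e := by exact_mod_cast he0
    nlinarith
  · rw [Nat.support_factorization]
    exact Nat.nonempty_primeFactors.2 hM

end Selberg

/-! ### Degree zero -/

namespace Selberg

open Complex Bornology Topology

section DegreeZero

variable {a : ArithmeticFunction ℂ} {F : ℂ → ℂ} {ε : ℂ} {Q : ℝ} {w : Fin 0 → ℝ} {μ : Fin 0 → ℂ}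

theorem SatisfiesFE.norm_of_degree_zero (hFE : SatisfiesFE F ε Q w μ) {s : ℂ} (h0 : s ≠ 0)
    (h1 : s ≠ 1) : ‖F s‖ = Q ^ (1 - 2 * s.re) * ‖F (1 - starRingEnd ℂ s)‖ := by
  obtain ⟨hε, hQ, -, -, h⟩ := hFE
  have h2 := congrArg norm (h s h0 h1 (fun i => i.elim0) (fun i => i.elim0))
  simp only [gammaFactor, Finset.univ_eq_empty, Finset.prod_empty, mul_one, norm_mul,
    Complex.norm_conj, hε, one_mul, norm_cpow_eq_rpow_re_of_pos hQ] at h2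
  have h3 : (1 - starRingEnd ℂ s).re = 1 - s.re := by simp
  rw [h3] at h2
  have h4 : Q ^ (1 - 2 * s.re) = Q ^ (1 - s.re) / Q ^ s.re := by
    rw [← Real.rpow_sub hQ]
    congr 1
    ring
  rw [h4, div_mul_eq_mul_div, ← h2, mul_div_cancel_left₀ _ (by positivity)]

/-- Without gamma factors the functional equation bounds `F` near `1` by its values near `0`, where
it is regular, so the singularity at `1` is removable. -/
theorem exists_entire_of_degree_zero (hFE : SatisfiesFE F ε Q w μ) {G : ℂ → ℂ} {m : ℕ}
    (hG : Differentiable ℂ G) (hGF : ∀ s : ℂ, s ≠ 1 → G s = (s - 1) ^ m * F s) :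
    ∃ E : ℂ → ℂ, Differentiable ℂ E ∧ ∀ s, s ≠ 1 → E s = F s := by
  have hQ := hFE.2.1
  have hF : ∀ s, s ≠ 1 → F s = G s / (s - 1) ^ m := fun s hs => by
    rw [hGF s hs, mul_div_cancel_left₀ _ (pow_ne_zero _ (sub_ne_zero.2 hs))]
  have hFd : ∀ s, s ≠ 1 → DifferentiableAt ℂ F s := by
    intro s hs
    have h1 : DifferentiableAt ℂ (fun s => G s / (s - 1) ^ m) s :=
      (hG s).div (by fun_prop) (pow_ne_zero _ (sub_ne_zero.2 hs))
    refine h1.congr_of_eventuallyEq ?_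
    filter_upwards [isOpen_ne.mem_nhds hs] with z hz using hF z hz
  set B : Set ℂ := Metric.ball 1 (1 / 2)
  have hcont : ContinuousOn
      (fun s : ℂ => Q ^ (1 - 2 * s.re) * ‖F (1 - starRingEnd ℂ s)‖) (Metric.closedBall 1 (1 / 2)) := by
    intro s hs
    refine ContinuousAt.continuousWithinAt ?_
    have hs0 : 1 - starRingEnd ℂ s ≠ 1 := by
      intro h
      have : s = 0 := by simpa using h
      rw [this] at hs
      norm_num at hs
    refine ContinuousAt.mul ?_ ?_
    · exact ContinuousAt.rpow (by fun_prop) (by fun_prop) (Or.inl hQ.ne')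
    · refine ContinuousAt.norm ?_
      refine ContinuousAt.comp (f := fun s : ℂ => 1 - starRingEnd ℂ s)
        (hFd _ hs0).continuousAt ?_
      exact (continuous_const.sub continuous_conj).continuousAt
  obtain ⟨M, hM⟩ := (isCompact_closedBall (1 : ℂ) (1 / 2)).exists_bound_of_continuousOn hcont
  have hbdd : BddAbove (norm ∘ F '' (B \ {1})) := by
    refine ⟨M, ?_⟩
    rintro _ ⟨s, ⟨hs, hs1⟩, rfl⟩
    have hs1 : s ≠ 1 := hs1
    have hs0 : s ≠ 0 := by
      rintro rfl
      norm_num [B] at hs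
    have := hM s (Metric.ball_subset_closedBall hs)
    rw [Function.comp, hFE.norm_of_degree_zero hs0 hs1]
    exact (le_abs_self _).trans this
  have hB : B ∈ 𝓝 (1 : ℂ) := Metric.ball_mem_nhds _ (by norm_num)
  have h := differentiableOn_update_limUnder_of_bddAbove hB
    (fun s hs => (hFd s hs.2).differentiableWithinAt) hbdd
  refine ⟨Function.update F 1 ((𝓝[≠] 1).limUnder F), fun s => ?_, fun s hs => Function.update_of_ne hs _ _⟩
  by_cases hs : s = 1
  · rw [hs]
    exact h.differentiableAt hB
  · refine (hFd s hs).congr_of_eventuallyEq ?_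
    filter_upwards [isOpen_ne.mem_nhds hs] with z hz using Function.update_of_ne hz _ _

theorem one_sub_conj_vert_neg (σ t : ℝ) : 1 - starRingEnd ℂ (vert (-σ) t) = vert (1 + σ) t := by
  rw [one_sub_conj_vert, sub_neg_eq_add]

theorem vert_ne_zero {σ : ℝ} (hσ : σ ≠ 0) (t : ℝ) : vert σ t ≠ 0 := by
  intro h
  have := congrArg re h
  simp at this
  exact hσ this

/-- Coefficients of index larger than `Q ^ 2` vanish in degree zero. -/
theorem coeff_eq_zero_of_degree_zero (hFE : SatisfiesFE F ε Q w μ) (hF : HasAnalyticity a F)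
    (hr : HasRamanujan a) {N : ℕ} (hN : Q ^ 2 < N) : a N = 0 := by
  obtain ⟨hFa, m, G, hG, ⟨ρ, hρ⟩, hGF⟩ := id hF
  obtain ⟨E, hE, hEF⟩ := exists_entire_of_degree_zero hFE hG hGF
  have hQ := hFE.2.1
  have hs2 : LSeriesSummable a 2 := hr.lseriesSummable (by norm_num)
  have hN0 : (0 : ℝ) < N := (by positivity : 0 < Q ^ 2).trans hN
  set K := ∑' n, ‖LSeries.term a 2 n‖
  have hline : ∀ A : ℝ, 1 ≤ A → ∀ t : ℝ, ‖E (vert (-A) t)‖ ≤ Q ^ (1 + 2 * A) * K := by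
    intro A hA t
    rw [hEF _ (vert_ne_one (by linarith) t), hFE.norm_of_degree_zero
      (vert_ne_zero (by linarith) t) (vert_ne_one (by linarith) t), one_sub_conj_vert_neg, vert_re]
    rw [show 1 - 2 * -A = 1 + 2 * A by ring, hFa _ (by rw [vert_re]; linarith)]
    gcongr
    have hsA : LSeriesSummable a (vert (1 + A) t) := hr.lseriesSummable (by rw [vert_re]; linarith)
    refine tsum_of_norm_bounded hs2.norm.hasSum fun n => ?_
    rw [LSeries.norm_term_eq, LSeries.norm_term_eq]
    split_ifs with hn
    · rfl
    · have hn1 : (1 : ℝ) ≤ n := by exact_mod_cast Nat.pos_of_ne_zero hn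
      have : (n : ℝ) ^ (2 : ℂ).re ≤ (n : ℝ) ^ (vert (1 + A) t).re :=
        Real.rpow_le_rpow_of_exponent_le hn1 (by rw [vert_re]; simp; linarith)
      gcongr
  -- The line bound `Q ^ (1 + 2A) K` competes with `N ^ (-A)`. For `N > Q²` the ratio tends to `0`
  -- as `A → ∞`.
  have hbound : ∀ A : ℝ, 1 ≤ A →
      ‖a N‖ ≤ (Q ^ 2 / N) ^ A * (Q * K * Real.exp (1 / 2) * √2) := by
    intro A hA
    have hstrip : PolyBoundedStrip E (-A) 2 := by
      refine (hFE.polyBoundedStrip hF hr hG hρ hGF (by linarith)).of_le_off_ball (K := 1)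
        hE.continuous fun s _ _ hs => ?_
      have hs1 : s ≠ 1 := by
        rintro rfl
        norm_num at hs
      rw [hEF s hs1, hGF s hs1, one_mul, norm_mul, norm_pow]
      exact le_mul_of_one_le_left (norm_nonneg _) (one_le_pow₀ hs)
    refine (norm_coeff_le_of_bounded hE hs2
      (fun s hs => (hEF s (ne_one_of_one_lt_re hs)).trans (hFa s hs)) (by linarith) hstrip
      (hline A hA) (by exact_mod_cast hN0)).trans (le_of_eq ?_)
    rw [Real.div_rpow (by positivity) hN0.le, Real.rpow_add hQ, Real.rpow_mul hQ.le,
      Real.rpow_neg hN0.le, Real.rpow_one, Real.rpow_two]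
    ring
  have hlt : Q ^ 2 / N < 1 := (div_lt_one hN0).2 hN
  have hlim : Tendsto (fun A : ℝ => (Q ^ 2 / N) ^ A * (Q * K * Real.exp (1 / 2) * √2)) atTop
      (𝓝 0) := by
    simpa using (tendsto_rpow_atTop_of_base_lt_one _ (by
      have : 0 < Q ^ 2 / N := by positivity
      linarith) hlt).mul_const (Q * K * Real.exp (1 / 2) * √2)
  have := ge_of_tendsto hlim (eventually_ge_atTop 1 |>.mono hbound)
  simpa using this

/-- A Dirichlet polynomial `∑ aₙ nˢ` divided by its leading power tends to its leading
coefficient. -/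
theorem tendsto_dirichletPolynomial_div {c : ℕ → ℂ} {M : ℕ} (hM : 0 < M) :
    Tendsto (fun x : ℝ => ∑ n ∈ Finset.Icc 1 M, c n * (((n : ℝ) / M) ^ x : ℝ)) atTop
      (𝓝 (c M)) := by
  have hM0 : (0 : ℝ) < M := by exact_mod_cast hM
  have h : ∀ n ∈ Finset.Icc 1 M, Tendsto (fun x : ℝ => c n * (((n : ℝ) / M) ^ x : ℝ)) atTop
      (𝓝 (if n = M then c n else 0)) := by
    intro n hn
    rw [Finset.mem_Icc] at hn
    split_ifs with hnM
    · rw [hnM, div_self hM0.ne']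
      simp
    · have h1 : (n : ℝ) / M < 1 := by
        rw [div_lt_one hM0]
        exact_mod_cast lt_of_le_of_ne hn.2 hnM
      have h2 : 0 ≤ (n : ℝ) / M := by positivity
      have h3 := (continuous_ofReal.tendsto _).comp
        (tendsto_rpow_atTop_of_base_lt_one _ (by linarith) h1)
      simpa using h3.const_mul (c n)
  have h4 := tendsto_finsetSum _ h
  rw [Finset.sum_ite_eq' (Finset.Icc 1 M) M, if_pos (by simp; omega)] at h4
  exact h4

theorem LSeries_eq_sum_of_forall_lt {c : ℕ → ℂ} {M : ℕ} (hc : ∀ n, M < n → c n = 0) (s : ℂ) :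
    LSeries c s = ∑ n ∈ Finset.Icc 1 M, c n / (n : ℂ) ^ s := by
  rw [LSeries, tsum_eq_sum (s := Finset.Icc 1 M)]
  · refine Finset.sum_congr rfl fun n hn => ?_
    rw [LSeries.term_of_ne_zero (by simp at hn; omega)]
  · intro n hn
    rcases Nat.eq_zero_or_pos n with rfl | hn0
    · simp
    · rw [LSeries.term_of_ne_zero hn0.ne', hc n, zero_div]
      simp only [Finset.mem_Icc, not_and, not_le] at hn
      exact hn hn0

/-- The only element of the Selberg class of degree zero is `1`. -/
theorem eq_one_of_degree_zero (hFE : SatisfiesFE F ε Q w μ) (hF : HasAnalyticity a F)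
    (hr : HasRamanujan a) (he : HasEulerProduct a) : a = 1 := by
  have hQ := hFE.2.1
  have hzero : ∀ n : ℕ, Q ^ 2 < n → a n = 0 := fun n hn =>
    coeff_eq_zero_of_degree_zero hFE hF hr hn
  have ha1 := he.1
  obtain ⟨M, haM, hlast⟩ : ∃ M, a M ≠ 0 ∧ ∀ n, M < n → a n = 0 := by
    have hfin : ∀ n, a n ≠ 0 → n ≤ ⌊Q ^ 2⌋₊ := fun n hn =>
      Nat.le_floor (not_lt.1 fun h => hn (hzero n h))
    have hex : ∃ n, a n ≠ 0 := ⟨1, by rw [ha1]; exact one_ne_zero⟩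
    classical
    refine ⟨Nat.findGreatest (fun n => a n ≠ 0) ⌊Q ^ 2⌋₊, ?_, fun n hn => ?_⟩
    · obtain ⟨n, hn⟩ := hex
      exact Nat.findGreatest_spec (P := fun n => a n ≠ 0) (hfin n hn) hn
    · by_contra h
      exact Nat.findGreatest_is_greatest hn (hfin n h) h
  have hM1 : 1 ≤ M := by
    by_contra h
    have : a 1 = 0 := hlast 1 (by omega)
    rw [ha1] at this
    exact one_ne_zero this
  rcases hM1.eq_or_lt with hM | hM
  · ext n
    rcases Nat.lt_trichotomy n 1 with h | rfl | h
    · obtain rfl : n = 0 := by omega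
      simp
    · rw [ha1, ArithmeticFunction.one_one]
    · rw [hlast n (by omega), ArithmeticFunction.one_apply_ne h.ne']
  exfalso
  have hM0 : (0 : ℝ) < M := by exact_mod_cast hM1
  have hMQ : (M : ℝ) ≤ Q ^ 2 := not_lt.1 fun h => haM (hzero M h)
  have hlt := norm_last_coeff_lt hr he hM haM hlast
  have hsum : ∀ s, LSeriesSummable a s := fun s => by
    refine summable_of_ne_finset_zero (s := Finset.Icc 1 M) fun n hn => ?_
    rcases Nat.eq_zero_or_pos n with rfl | hn0
    · simp
    · rw [LSeries.term_of_ne_zero hn0.ne', hlast n, zero_div]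
      simp only [Finset.mem_Icc, not_and, not_le] at hn
      exact hn hn0
  have hFL : ∀ s, s ≠ 1 → F s = LSeries a s := by
    obtain ⟨hFa, m, G, hG, -, hGF⟩ := hF
    obtain ⟨E, hE, hEF⟩ := exists_entire_of_degree_zero hFE hG hGF
    intro s hs
    rw [← hEF s hs, eq_of_eq_on_re_gt_one hE (differentiable_LSeries_of_summable hsum)
      fun z hz => (hEF z (ne_one_of_one_lt_re hz)).trans (hFa z hz)]
  have hleft := (tendsto_dirichletPolynomial_div (c := a) hM1).norm
  have hright : Tendsto (fun x : ℝ => ‖LSeries a ((1 + x : ℝ) : ℂ)‖) atTop (𝓝 1) := by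
    have h1 : Tendsto (fun x : ℝ => ∑ n ∈ Finset.Icc 1 M, a n / (n : ℂ) ^ ((1 + x : ℝ) : ℂ)) atTop
        (𝓝 (∑ n ∈ Finset.Icc 1 M, if n = 1 then a n else 0)) := by
      refine tendsto_finsetSum _ fun n hn => ?_
      rw [Finset.mem_Icc] at hn
      split_ifs with hn1
      · rw [hn1]
        simp
      · have hn2 : (1 : ℝ) < n := by exact_mod_cast lt_of_le_of_ne hn.1 (Ne.symm hn1)
        have h2 : Tendsto (fun x : ℝ => ‖a n‖ * ((n : ℝ) ^ (1 + x))⁻¹) atTop (𝓝 0) := by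
          have h3 : Tendsto (fun x : ℝ => (n : ℝ) ^ (1 + x)) atTop atTop :=
            (tendsto_rpow_atTop_of_base_gt_one _ hn2).comp (tendsto_atTop_add_const_left _ _ tendsto_id)
          simpa using h3.inv_tendsto_atTop.const_mul ‖a n‖
        refine squeeze_zero_norm (fun x => le_of_eq ?_) h2
        rw [norm_div, norm_natCast_cpow_of_pos (by omega), ofReal_re, div_eq_mul_inv]
    rw [Finset.sum_ite_eq' (Finset.Icc 1 M) 1, if_pos (by simp; omega), ha1] at h1
    have h4 := h1.norm
    rw [norm_one] at h4
    refine h4.congr fun x => ?_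
    rw [LSeries_eq_sum_of_forall_lt hlast]
  -- The functional equation at `s = -x`, divided by `M ^ x`. As `x → ∞` the left side tends to
  -- `|a_M|`, while the right side is at least `Q |F(1 + x)|`, which tends to `Q`, because `M ≤ Q²`.
  have hident : ∀ x : ℝ, 0 < x → ‖∑ n ∈ Finset.Icc 1 M, a n * (((n : ℝ) / M) ^ x : ℝ)‖ =
      (Q ^ 2 / M) ^ x * (Q * ‖LSeries a ((1 + x : ℝ) : ℂ)‖) := by
    intro x hx
    have hne0 : ((-x : ℝ) : ℂ) ≠ 0 := by exact_mod_cast (by linarith : -x ≠ 0)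
    have hne1 : ((-x : ℝ) : ℂ) ≠ 1 := by exact_mod_cast (by linarith : -x ≠ 1)
    have hne2 : ((1 + x : ℝ) : ℂ) ≠ 1 := by exact_mod_cast (by linarith : 1 + x ≠ 1)
    have h1 := hFE.norm_of_degree_zero hne0 hne1
    have h2 : 1 - starRingEnd ℂ ((-x : ℝ) : ℂ) = ((1 + x : ℝ) : ℂ) := by
      rw [conj_ofReal]
      push_cast
      ring
    rw [h2, hFL _ hne1, hFL _ hne2, ofReal_re, LSeries_eq_sum_of_forall_lt hlast] at h1
    have h3 : ∑ n ∈ Finset.Icc 1 M, a n * (((n : ℝ) / M) ^ x : ℝ) =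
        (((M : ℝ) ^ x)⁻¹ : ℝ) * ∑ n ∈ Finset.Icc 1 M, a n / (n : ℂ) ^ ((-x : ℝ) : ℂ) := by
      rw [Finset.mul_sum]
      refine Finset.sum_congr rfl fun n hn => ?_
      rw [Real.div_rpow (by positivity) (by positivity), ← ofReal_natCast n, ← ofReal_cpow
        (by positivity), Real.rpow_neg (by positivity)]
      push_cast
      rw [div_inv_eq_mul]
      ring
    rw [h3, norm_mul, h1, Complex.norm_real, Real.norm_of_nonneg (by positivity),
      Real.div_rpow (by positivity) hM0.le, show 1 - 2 * -x = 1 + 2 * x by ring,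
      Real.rpow_add hQ, Real.rpow_mul hQ.le, Real.rpow_one, Real.rpow_two]
    ring
  have hlim2 := hleft.congr' (eventually_gt_atTop 0 |>.mono hident)
  have hge : Q ≤ ‖a M‖ := by
    have h5 : Tendsto (fun x : ℝ => Q * ‖LSeries a ((1 + x : ℝ) : ℂ)‖) atTop (𝓝 Q) := by
      simpa using hright.const_mul Q
    refine le_of_tendsto_of_tendsto h5 hlim2 ?_
    filter_upwards [eventually_ge_atTop 0] with x hx
    refine le_mul_of_one_le_left (by positivity) ?_
    exact Real.one_le_rpow ((one_le_div hM0).2 hMQ) hx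
  have : √M ≤ Q := by
    rw [Real.sqrt_le_left hQ.le]
    exact hMQ
  linarith

end DegreeZero

theorem HasHalfDegree.ge_of_ne_one {a : ArithmeticFunction ℂ} (hr : HasRamanujan a)
    (he : HasEulerProduct a) {W : ℝ} (h : HasHalfDegree a W) (ha : a ≠ 1) : 1 / 4 ≤ W := by
  obtain ⟨F, hF, ε, Q, k, w, μ, hFE, rfl⟩ := h
  by_contra! hlt
  have h1 := hFE.sum_nonpos hF hr he hlt
  rcases Nat.eq_zero_or_pos k with rfl | hk
  · exact ha (eq_one_of_degree_zero hFE hF hr he)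
  · have : 0 < ∑ i, w i := Finset.sum_pos (fun i _ => hFE.2.2.1 i) ⟨⟨0, hk⟩, Finset.mem_univ _⟩
    linarith

end Selberg

/-! ### Existence of a primitive factorization -/

namespace Selberg

open Topology

/-- Induction on an integer bound for `4 W`: in a nontrivial splitting each factor takes at least
`1/4` of the half-degree, so the bound for the other drops by at least one. -/
theorem exists_primitive_factorization {F : ArithmeticFunction ℂ} (hF : F ∈ SelbergClass) :
    ∃ M : Multiset (ArithmeticFunction ℂ), (∀ P ∈ M, IsPrimitive P) ∧ M.prod = F := by
  obtain ⟨W, hW⟩ := exists_hasHalfDegree hF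
  obtain ⟨n, hn⟩ := exists_nat_gt (4 * W)
  induction n generalizing F W with
  | zero =>
    refine ⟨0, by simp, ?_⟩
    rw [Multiset.prod_zero]
    by_contra h
    have := hW.ge_of_ne_one hF.2.1 hF.2.2 (Ne.symm h)
    norm_num at hn
    linarith
  | succ n ih =>
    by_cases h1 : F = 1
    · exact ⟨0, by simp, by rw [h1, Multiset.prod_zero]⟩
    by_cases hprim : IsPrimitive F
    · exact ⟨{F}, by simpa using hprim, Multiset.prod_singleton F⟩
    simp only [IsPrimitive, not_and, not_forall, not_or] at hprim
    obtain ⟨F₁, hF₁, F₂, hF₂, hmul, hne₁, hne₂⟩ := hprim hF h1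
    obtain ⟨W₁, hW₁⟩ := exists_hasHalfDegree hF₁
    obtain ⟨W₂, hW₂⟩ := exists_hasHalfDegree hF₂
    have hsum : W₁ + W₂ ≤ W :=
      HasHalfDegree.le hF.2.1 hF.2.2 (hmul ▸ hW₁.mul hF₁.2.1 hF₂.2.1 hW₂) hW
    have hge₁ := hW₁.ge_of_ne_one hF₁.2.1 hF₁.2.2 hne₁
    have hge₂ := hW₂.ge_of_ne_one hF₂.2.1 hF₂.2.2 hne₂
    push_cast at hn
    obtain ⟨M₁, hM₁, hprod₁⟩ := ih hF₁ W₁ hW₁ (by linarith)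
    obtain ⟨M₂, hM₂, hprod₂⟩ := ih hF₂ W₂ hW₂ (by linarith)
    refine ⟨M₁ + M₂, fun P hP => ?_, by rw [Multiset.prod_add, hprod₁, hprod₂, hmul]⟩
    rcases Multiset.mem_add.1 hP with h | h
    · exact hM₁ P h
    · exact hM₂ P h

/-! ### Uniqueness from orthonormality -/

theorem prod_apply_one {M : Multiset (ArithmeticFunction ℂ)} (hM : ∀ P ∈ M, P 1 = 1) :
    M.prod 1 = 1 := by
  induction M using Multiset.induction_on with
  | empty => simp
  | cons P M ih =>
    rw [Multiset.prod_cons, ArithmeticFunction.mul_apply_one, hM P (Multiset.mem_cons_self P M),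
      ih fun Q hQ => hM Q (Multiset.mem_cons_of_mem hQ), one_mul]

/-- A prime has only the divisors `1` and `p`, so Dirichlet convolution with `a₁ = 1` becomes
addition there. This makes the pairing over primes linear in the factors. -/
theorem prod_apply_prime {M : Multiset (ArithmeticFunction ℂ)} (hM : ∀ P ∈ M, P 1 = 1) {p : ℕ}
    (hp : p.Prime) : M.prod p = (M.map fun P => P p).sum := by
  induction M using Multiset.induction_on with
  | empty => simp [ArithmeticFunction.one_apply_ne hp.ne_one]
  | cons P M ih =>
    have hM' : ∀ Q ∈ M, Q 1 = 1 := fun Q hQ => hM Q (Multiset.mem_cons_of_mem hQ)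
    rw [Multiset.prod_cons, Multiset.map_cons, Multiset.sum_cons, ← ih hM',
      ArithmeticFunction.mul_apply, Nat.sum_divisorsAntidiagonal fun i j => P i * M.prod j,
      hp.sum_divisors, Nat.div_self hp.pos, Nat.div_one, hM P (Multiset.mem_cons_self P M),
      prod_apply_one hM']
    ring

/-- The partial sums `∑_{p ≤ x} aₚ conj(bₚ) / p`. -/
noncomputable def primeInner (a b : ArithmeticFunction ℂ) (x : ℝ) : ℂ :=
  ∑ p ∈ Finset.Iic ⌊x⌋₊ with p.Prime, a p * starRingEnd ℂ (b p) / (p : ℂ)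

theorem primeInner_prod {M : Multiset (ArithmeticFunction ℂ)} (hM : ∀ P ∈ M, P 1 = 1)
    (b : ArithmeticFunction ℂ) (x : ℝ) :
    primeInner M.prod b x = (M.map fun P => primeInner P b x).sum := by
  have h : primeInner M.prod b x = ∑ p ∈ Finset.Iic ⌊x⌋₊ with p.Prime,
      (M.map fun P : ArithmeticFunction ℂ => P p).sum * (starRingEnd ℂ (b p) / (p : ℂ)) := by
    refine Finset.sum_congr rfl fun p hp => ?_
    rw [prod_apply_prime hM (Finset.mem_filter.1 hp).2, mul_div_assoc]
  rw [h]
  clear h hM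
  induction M using Multiset.induction_on with
  | empty => simp
  | cons P M ih =>
    simp only [Multiset.map_cons, Multiset.sum_cons, add_mul, Finset.sum_add_distrib]
    rw [ih, primeInner]
    simp only [mul_div_assoc]

theorem HasSelbergNumber.primeInner_self {a : ArithmeticFunction ℂ} {n : ℤ}
    (h : HasSelbergNumber a n) :
    (fun x => primeInner a a x - n * (Real.log (Real.log x) : ℂ)) =O[atTop]
      fun _ : ℝ => (1 : ℝ) := by
  refine (IsBigO.of_norm_norm (h.norm_norm.congr_left fun x => ?_))
  rw [← Complex.norm_real]
  congr 1
  push_cast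
  congr 1
  refine Finset.sum_congr rfl fun p _ => ?_
  rw [Complex.mul_conj']

-- Each copy of `P` contributes `log log x + O(1)` and every other factor `O(1)`, so the pairing
-- with `P` reads off its multiplicity.
open Classical in
theorem primeInner_prod_sub_count {M : Multiset (ArithmeticFunction ℂ)}
    (P : ArithmeticFunction ℂ) (hP : HasSelbergNumber P 1)
    (horth : ∀ Q ∈ M, Q ≠ P → primeInner Q P =O[atTop] fun _ : ℝ => (1 : ℝ)) :
    (fun x => (M.map fun Q => primeInner Q P x).sum -
      M.count P * (Real.log (Real.log x) : ℂ)) =O[atTop] fun _ : ℝ => (1 : ℝ) := by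
  induction M using Multiset.induction_on with
  | empty => exact IsBigO.of_bound 0 (by simp)
  | cons Q M ih =>
    have h := ih fun R hR => horth R (Multiset.mem_cons_of_mem hR)
    by_cases hQ : Q = P
    · subst hQ
      refine (h.add hP.primeInner_self).congr_left fun x => ?_
      rw [Multiset.map_cons, Multiset.sum_cons, Multiset.count_cons_self]
      push_cast
      ring
    · refine (h.add (horth Q (Multiset.mem_cons_self Q M) hQ)).congr_left fun x => ?_
      rw [Multiset.map_cons, Multiset.sum_cons, Multiset.count_cons_of_ne (Ne.symm hQ)]
      ring

theorem eq_of_sub_mul_loglog_isBigO {m n : ℕ} {f : ℝ → ℂ}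
    (hm : (fun x => f x - m * (Real.log (Real.log x) : ℂ)) =O[atTop] fun _ : ℝ => (1 : ℝ))
    (hn : (fun x => f x - n * (Real.log (Real.log x) : ℂ)) =O[atTop] fun _ : ℝ => (1 : ℝ)) :
    m = n := by
  by_contra hne
  have h0 : ((n : ℂ) - m) ≠ 0 := sub_ne_zero.2 (by exact_mod_cast Ne.symm hne)
  have h1 : (fun x => ((n : ℂ) - m) * (Real.log (Real.log x) : ℂ)) =O[atTop]
      fun _ : ℝ => (1 : ℝ) := (hm.sub hn).congr_left fun x => by ring
  have h2 := (isBigO_const_mul_left_iff h0).1 h1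
  have h3 : Tendsto (fun x : ℝ => ‖(Real.log (Real.log x) : ℂ)‖) atTop atTop := by
    simp_rw [Complex.norm_real]
    exact tendsto_norm_atTop_atTop.comp (Real.tendsto_log_atTop.comp Real.tendsto_log_atTop)
  exact not_isBoundedUnder_of_tendsto_atTop h3 ((isBigO_one_iff ℝ).1 h2)

/-- Up to the first index `N > 1` that may carry a coefficient, only the divisor pairs `(1, n)` and
`(n, 1)` contribute, so multiplication adds coefficients. The value `k P(N)` then recovers `k`. -/
theorem pow_apply_first_nonzero {P : ArithmeticFunction ℂ} (h1 : P 1 = 1) {N : ℕ} (hN : 1 < N)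
    (hP : ∀ n, 1 < n → n < N → P n = 0) (k : ℕ) :
    (P ^ k) 1 = 1 ∧ (∀ n, 1 < n → n < N → (P ^ k) n = 0) ∧ (P ^ k) N = k * P N := by
  induction k with
  | zero =>
    refine ⟨by simp, fun n hn _ => ?_, ?_⟩
    · rw [pow_zero, ArithmeticFunction.one_apply_ne hn.ne']
    · rw [pow_zero, ArithmeticFunction.one_apply_ne hN.ne']
      simp
  | succ k ih =>
    obtain ⟨ih1, ih2, ih3⟩ := ih
    have hmul : ∀ n, 1 < n → n ≤ N → (P ^ (k + 1)) n = (P ^ k) n + P n := by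
      intro n hn hnN
      rw [pow_succ, ArithmeticFunction.mul_apply]
      have hsub : ({(1, n), (n, 1)} : Finset (ℕ × ℕ)) ⊆ n.divisorsAntidiagonal := by
        intro q hq
        simp only [Finset.mem_insert, Finset.mem_singleton] at hq
        rcases hq with rfl | rfl <;> simp [Nat.mem_divisorsAntidiagonal] <;> omega
      rw [← Finset.sum_subset hsub, Finset.sum_pair (by simp; omega), ih1, h1, one_mul, mul_one,
        add_comm]
      rintro ⟨i, j⟩ hij hnot
      simp only [Nat.mem_divisorsAntidiagonal] at hij
      simp only [Finset.mem_insert, Finset.mem_singleton, Prod.mk.injEq, not_or] at hnot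
      obtain ⟨rfl, hij0⟩ := hij
      have hi : 1 < i := by
        rcases i with _ | _ | i
        · simp at hij0
        · exact absurd (by simp) hnot.1
        · omega
      have hj : 1 < j := by
        rcases j with _ | _ | j
        · simp at hij0
        · exact absurd (by simp) hnot.2
        · omega
      rw [ih2 i hi (by nlinarith), zero_mul]
    refine ⟨?_, fun n hn hnN => ?_, ?_⟩
    · rw [pow_succ, ArithmeticFunction.mul_apply_one, ih1, h1, one_mul]
    · rw [hmul n hn hnN.le, ih2 n hn hnN, hP n hn hnN, zero_add]
    · rw [hmul N hN le_rfl, ih3]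
      push_cast
      ring

theorem pow_left_injective_of_ne_one {P : ArithmeticFunction ℂ} (h1 : P 1 = 1) (hne : P ≠ 1)
    {m n : ℕ} (h : P ^ m = P ^ n) : m = n := by
  classical
  have hex : ∃ N, 1 < N ∧ P N ≠ 0 := by
    by_contra! hall
    refine hne (ArithmeticFunction.ext fun n => ?_)
    rcases Nat.lt_trichotomy n 1 with hn | rfl | hn
    · obtain rfl : n = 0 := by omega
      simp
    · rw [h1, ArithmeticFunction.one_one]
    · rw [hall n hn, ArithmeticFunction.one_apply_ne hn.ne']
  obtain ⟨hN, hPN⟩ := Nat.find_spec hex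
  have hmin : ∀ l, 1 < l → l < Nat.find hex → P l = 0 := by
    intro l hl hlt
    by_contra hne
    exact Nat.find_min hex hlt ⟨hl, hne⟩
  have hm := (pow_apply_first_nonzero h1 hN hmin m).2.2
  rw [h, (pow_apply_first_nonzero h1 hN hmin n).2.2] at hm
  exact_mod_cast (mul_right_cancel₀ hPN hm).symm

theorem primitive_factorization_unique (horth : OrthonormalityConjecture)
    {M M' : Multiset (ArithmeticFunction ℂ)} (hM : ∀ P ∈ M, IsPrimitive P)
    (hM' : ∀ P ∈ M', IsPrimitive P) (h : M.prod = M'.prod) : M = M' := by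
  classical
  have hone : ∀ {P}, IsPrimitive P → P 1 = 1 := fun hP => hP.1.2.2.1
  -- Orthonormality concerns pairs of distinct primitive elements, so even `n_P = 1` is available
  -- only when a second one exists.
  by_cases hex : ∃ P P', IsPrimitive P ∧ IsPrimitive P' ∧ P ≠ P'
  · obtain ⟨P₁, P₂, hP₁, hP₂, hne⟩ := hex
    ext P
    by_cases hP : IsPrimitive P
    · have hnum : HasSelbergNumber P 1 := by
        by_cases hPP : P = P₁
        · subst hPP
          exact (horth P P₂ hP hP₂ hne).1
        · exact (horth P P₁ hP hP₁ hPP).1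
      have key : ∀ N : Multiset (ArithmeticFunction ℂ), (∀ Q ∈ N, IsPrimitive Q) →
          (fun x => primeInner N.prod P x - N.count P * (Real.log (Real.log x) : ℂ)) =O[atTop]
            fun _ : ℝ => (1 : ℝ) := by
        intro N hN
        simp_rw [primeInner_prod fun Q hQ => hone (hN Q hQ)]
        exact primeInner_prod_sub_count P hnum fun Q hQ hQP => (horth Q P (hN Q hQ) hP hQP).2
      have h1 := key M hM
      rw [h] at h1
      exact eq_of_sub_mul_loglog_isBigO h1 (key M' hM')
    · rw [Multiset.count_eq_zero_of_notMem fun hmem => hP (hM P hmem),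
        Multiset.count_eq_zero_of_notMem fun hmem => hP (hM' P hmem)]
  · push Not at hex
    by_cases hP : ∃ P, IsPrimitive P
    · obtain ⟨P, hP⟩ := hP
      -- With a single primitive element every factorization is a power of it, and the exponent is
      -- determined without any conjecture.
      have hrep : ∀ N : Multiset (ArithmeticFunction ℂ), (∀ Q ∈ N, IsPrimitive Q) →
          N = Multiset.replicate N.card P := fun N hN =>
        Multiset.eq_replicate.2 ⟨rfl, fun Q hQ => hex Q P (hN Q hQ) hP⟩
      rw [hrep M hM, hrep M' hM', Multiset.prod_replicate, Multiset.prod_replicate] at h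
      rw [hrep M hM, hrep M' hM', pow_left_injective_of_ne_one (hone hP) hP.2.1 h]
    · push Not at hP
      rw [Multiset.eq_zero_of_forall_notMem fun Q hQ => hP Q (hM Q hQ),
        Multiset.eq_zero_of_forall_notMem fun Q hQ => hP Q (hM' Q hQ)]

end Selberg

theorem proposition4p4
    (hreg : Selberg.RegularityConjecture) (horth : Selberg.OrthonormalityConjecture) :
    ∀ F ∈ Selberg.SelbergClass,
      ∃! M : Multiset (ArithmeticFunction ℂ), (∀ P ∈ M, Selberg.IsPrimitive P) ∧ M.prod = F := by
  intro F hF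
  obtain ⟨M, hM, hprod⟩ := Selberg.exists_primitive_factorization hF
  exact ⟨M, ⟨hM, hprod⟩, fun M' hM' =>
    Selberg.primitive_factorization_unique horth hM'.1 hM (hM'.2.trans hprod.symm)⟩
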